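/- Consider the mixed binary/ternary Hamming space $\mathbb Z_3^3\times\mathbb Z_2^4$, whose words are written as strings of $7$ symbols, the three ternary coordinates first and the four binary coordinates last. Let $d(w,x)$ be the Hamming distance of two words (the number of coordinates in which they differ), $d=d^b+d^t$, where $d^b$ and $d^t$ count the differing binary and ternary coordinates, respectively. The minimum distance of a code $C$ (a set of words) is the minimum of $d(w,x)$ over distinct $w,x\in C$ (and $\infty$ if $|C|\le 1$). Let $N(4,3;3)$ be the largest cardinality of a code $C\subseteq\mathbb Z_3^3\times\mathbb Z_2^4$ of minimum distance at least $3$. Then the following hold. 1. $N(4,3;3)=28$. 2. Every code $C\subseteq\mathbb Z_3^3\times\mathbb Z_2^4$ of minimum distance at least $3$ with $|C|\ge 17$ contains two words $w,w'$ with $d(w,w')=3$, $d^t(w,w')=3$ and $d^b(w,w')=0$, i.e. two words at distance $3$ that differ only in the ternary coordinates. 3. The following $28$ words are distinct and form a code of minimum distance exactly $3$: $0000000$, $0010101$, $0011010$, $0021111$, $0100110$, $0101011$, $0111100$, $0201101$, $0210011$, $0221000$, $1001100$, $1010110$, $1020001$, $1100101$, $1110000$, $1111111$, $1121010$, $1200010$,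 $1211001$, $1220111$, $2000111$, $2020010$, $2101000$, $2121101$, $2200001$, $2201110$, $2210100$, $2221011$. 4. The largest cardinality of a code $C\subseteq\mathbb Z_3^3\times\mathbb Z_2^4$ of minimum distance at least $3$ that contains both words $0000000$ and $1110000$ is also $28$. -/

import Mathlib

/-- Words of the mixed binary/ternary Hamming space with `b` binary and `t` ternary coordinates;
the ternary coordinates are written first. -/
abbrev MixedWord (b t : ℕ) : Type := (Fin t → ZMod 3) × (Fin b → ZMod 2)

namespace MixedCode

variable {b t : ℕ}

/-- Number of binary coordinates in which two words differ. -/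
def distB (w x : MixedWord b t) : ℕ := hammingDist w.2 x.2

/-- Number of ternary coordinates in which two words differ. -/
def distT (w x : MixedWord b t) : ℕ := hammingDist w.1 x.1

/-- The Hamming distance: the number of coordinates in which two words differ. -/
def dist (w x : MixedWord b t) : ℕ := distB w x + distT w x

/-- The minimum distance of a code, i.e. the minimum of the distances of its pairs of distinct
words. A code with at most one word has no such pair, and its minimum distance is `⊤`. -/
noncomputable def minDist (C : Finset (MixedWord b t)) : ℕ∞ :=
  ⨅ (w ∈ C) (x ∈ C) (_ : w ≠ x), (dist w x : ℕ∞)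

/-- The cardinalities of the codes of minimum distance at least `d`. -/
def codeSizes (b t d : ℕ) : Set ℕ :=
  {n | ∃ C : Finset (MixedWord b t), (d : ℕ∞) ≤ minDist C ∧ C.card = n}

/-- `N(b, t; d)`: the largest cardinality of a code with `b` binary coordinates, `t` ternary
coordinates and minimum distance (at least) `d`. -/
noncomputable def N (b t d : ℕ) : ℕ := sSup (codeSizes b t d)

/-- The supremum in the definition of `N` is a maximum. -/
theorem isGreatest_N (b t d : ℕ) : IsGreatest (codeSizes b t d) (N b t d) := by
  have hne : (codeSizes b t d).Nonempty := ⟨0, ∅, by simp [minDist], rfl⟩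
  have hb : BddAbove (codeSizes b t d) := by
    refine ⟨Fintype.card (MixedWord b t), ?_⟩
    rintro _ ⟨C, -, rfl⟩
    exact C.card_le_univ
  exact ⟨Nat.sSup_mem hne hb, fun _ hn => le_csSup hb hn⟩

/-- An explicit code in the space with 4 binary and 3 ternary coordinates. -/
def code28 : Finset (MixedWord 4 3) :=
  { (![0, 0, 0], ![0, 0, 0, 0]), (![0, 0, 1], ![0, 1, 0, 1]), (![0, 0, 1], ![1, 0, 1, 0]),
    (![0, 0, 2], ![1, 1, 1, 1]), (![0, 1, 0], ![0, 1, 1, 0]), (![0, 1, 0], ![1, 0, 1, 1]),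
    (![0, 1, 1], ![1, 1, 0, 0]), (![0, 2, 0], ![1, 1, 0, 1]), (![0, 2, 1], ![0, 0, 1, 1]),
    (![0, 2, 2], ![1, 0, 0, 0]), (![1, 0, 0], ![1, 1, 0, 0]), (![1, 0, 1], ![0, 1, 1, 0]),
    (![1, 0, 2], ![0, 0, 0, 1]), (![1, 1, 0], ![0, 1, 0, 1]), (![1, 1, 1], ![0, 0, 0, 0]),
    (![1, 1, 1], ![1, 1, 1, 1]), (![1, 1, 2], ![1, 0, 1, 0]), (![1, 2, 0], ![0, 0, 1, 0]),
    (![1, 2, 1], ![1, 0, 0, 1]), (![1, 2, 2], ![0, 1, 1, 1]), (![2, 0, 0], ![0, 1, 1, 1]),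
    (![2, 0, 2], ![0, 0, 1, 0]), (![2, 1, 0], ![1, 0, 0, 0]), (![2, 1, 2], ![1, 1, 0, 1]),
    (![2, 2, 0], ![0, 0, 0, 1]), (![2, 2, 0], ![1, 1, 1, 0]), (![2, 2, 1], ![0, 1, 0, 0]),
    (![2, 2, 2], ![1, 0, 1, 1]) }

end MixedCode

/-! The explicit code gives the lower bound in items 1 and 4, and item 2 is a pigeonhole argument
over the sixteen binary words. The substance is that no code has 29 words.

A code is a family of sets `m v` of ternary words, one for each vertex `v` of the 4-cube. Each `m v`
is a ternary code of minimum distance 3, hence one of 172 sets (1 empty, 27 singletons, 108 pairs,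
36 triples). Sets at adjacent vertices have distance at least 2, sets at vertices at distance 2 are
disjoint, and vertices further apart do not interact.

The cube splits into four square faces according to `v % 4`. With 29 words some face has `s ≥ 8`
words; isometries make it face 0, with face 1 at least as large as face 2 (`exists_isLarge`). Either
a vertex of face 0 carries a triple, which can be moved to vertex 0 and normalised to `{000, 111,
222}`, or `s = 8` and all four vertices carry pairs, the one at vertex 0 being normalised to `{000,
111}` (`not_isLarge`).

Each case is refuted by a depth-first search evaluated in the kernel. A state is one large number
holding the admissible sets of all vertices as bit blocks, so that propagation and the counting
bound take a few operations on big numbers. Symmetries are broken by taking a family that is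
lexicographically maximal at the vertices 12 and 4. Soundness rests on `Fits.next` (propagation
keeps a genuine code), `Fits.bound_eq_true` (the bound never rejects one), `IsRooted.passes` (nor do
the symmetry tests) and `search_eq_false` (hence a genuine code makes the search fail). -/

namespace MixedCode

/-! ### Numbers as sequences of binary blocks -/

/-- The number whose `m`-th block of `w` bits is `g m`, for `m < n`. -/
noncomputable def pack (w : ℕ) (g : ℕ → ℕ) (n : ℕ) : ℕ :=
  Nat.rec 0 (fun m ih => Nat.add ih (Nat.mul (g m) (Nat.pow 2 (Nat.mul w m)))) n

theorem pack_succ (w : ℕ) (g : ℕ → ℕ) (n : ℕ) :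
    pack w g (n + 1) = 2 ^ (w * n) * g n + pack w g n := by
  show pack w g n + g n * 2 ^ (w * n) = _
  rw [mul_comm, add_comm]

theorem pack_eq_sum (w : ℕ) (g : ℕ → ℕ) (n : ℕ) :
    pack w g n = ∑ m ∈ Finset.range n, g m * 2 ^ (w * m) := by
  induction n with
  | zero => rfl
  | succ n ih => rw [pack_succ, Finset.sum_range_succ, ih]; ring

theorem pack_congr {w : ℕ} {g h : ℕ → ℕ} {n : ℕ} (H : ∀ m < n, g m = h m) :
    pack w g n = pack w h n := by
  rw [pack_eq_sum, pack_eq_sum]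
  exact Finset.sum_congr rfl fun m hm => by rw [H m (Finset.mem_range.1 hm)]

theorem pack_lt {w : ℕ} {g : ℕ → ℕ} {n : ℕ} (H : ∀ m < n, g m < 2 ^ w) :
    pack w g n < 2 ^ (w * n) := by
  induction n with
  | zero => simp [pack]
  | succ n ih =>
    have h1 := ih fun m hm => H m (by omega)
    have h2 : g n + 1 ≤ 2 ^ w := H n (by omega)
    have h3 : 2 ^ (w * n) * (g n + 1) ≤ 2 ^ (w * n) * 2 ^ w := Nat.mul_le_mul_left _ h2
    rw [pack_succ, Nat.mul_succ w n, pow_add]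
    nlinarith

theorem testBit_pack {w : ℕ} {g : ℕ → ℕ} {n u j : ℕ} (H : ∀ m < n, g m < 2 ^ w) (hu : u < n)
    (hj : j < w) : (pack w g n).testBit (w * u + j) = (g u).testBit j := by
  induction n with
  | zero => omega
  | succ n ih =>
    have h1 := pack_lt fun m (hm : m < n) => H m (by omega)
    rw [pack_succ, Nat.testBit_two_pow_mul_add _ h1]
    rcases Nat.lt_succ_iff_lt_or_eq.1 hu with h | rfl
    · have : w * u + j < w * n := by
        have : w * (u + 1) ≤ w * n := Nat.mul_le_mul_left _ h
        rw [mul_add] at this; omega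
      rw [if_pos this]
      exact ih (fun m hm => H m (by omega)) h
    · rw [if_neg (by omega)]; congr 1; omega

theorem land_two_pow_mul_add {i a b x y : ℕ} (hx : x < 2 ^ i) (hy : y < 2 ^ i) :
    (2 ^ i * a + x) &&& (2 ^ i * b + y) = 2 ^ i * (a &&& b) + (x &&& y) := by
  have hxy : x &&& y < 2 ^ i := Nat.and_lt_two_pow _ hy
  refine Nat.eq_of_testBit_eq fun j => ?_
  rw [Nat.testBit_and, Nat.testBit_two_pow_mul_add _ hx, Nat.testBit_two_pow_mul_add _ hy,
    Nat.testBit_two_pow_mul_add _ hxy]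
  split_ifs <;> simp

theorem land_pack {w : ℕ} {g h : ℕ → ℕ} {n : ℕ} (hg : ∀ m < n, g m < 2 ^ w)
    (hh : ∀ m < n, h m < 2 ^ w) : pack w g n &&& pack w h n = pack w (fun m => g m &&& h m) n := by
  induction n with
  | zero => simp [pack]
  | succ n ih =>
    have hg' := fun m (hm : m < n) => hg m (by omega)
    have hh' := fun m (hm : m < n) => hh m (by omega)
    rw [pack_succ, pack_succ, pack_succ, land_two_pow_mul_add (pack_lt hg') (pack_lt hh'),
      ih hg' hh']

theorem pack_digits {w X : ℕ} (n : ℕ) (h : X < 2 ^ (w * n)) :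
    X = pack w (fun u => X / 2 ^ (w * u) % 2 ^ w) n := by
  induction n generalizing X with
  | zero => simpa [pack] using h
  | succ n ih =>
    have h1 : X % 2 ^ (w * n) < 2 ^ (w * n) := Nat.mod_lt _ (by positivity)
    have h2 : X / 2 ^ (w * n) < 2 ^ w := by
      rw [Nat.div_lt_iff_lt_mul (by positivity), ← pow_add]
      convert h using 2; ring
    have h3 : pack w (fun u => X / 2 ^ (w * u) % 2 ^ w) n = X % 2 ^ (w * n) := by
      conv_rhs => rw [ih h1]
      refine pack_congr fun m hm => ?_
      have hle : w * m + w ≤ w * n := by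
        have : w * (m + 1) ≤ w * n := Nat.mul_le_mul_left _ hm
        rwa [mul_add, mul_one] at this
      refine Nat.eq_of_testBit_eq fun j => ?_
      simp only [← Nat.shiftRight_eq_div_pow, Nat.testBit_mod_two_pow, Nat.testBit_shiftRight]
      by_cases hj : j < w
      · have : w * m + j < w * n := by omega
        simp [hj, this]
      · simp [hj]
    rw [pack_succ, h3, Nat.mod_eq_of_lt h2, Nat.div_add_mod]

/-- The number whose `i`-th bit tells whether the `i`-th entry of the list satisfies `p`. -/
noncomputable def bits (p : ℕ → Bool) (l : List ℕ) : ℕ :=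
  List.rec 0 (fun a _ ih => Nat.add (Bool.rec 0 1 (p a)) (Nat.mul 2 ih)) l

theorem bits_cons (p : ℕ → Bool) (a : ℕ) (l : List ℕ) :
    bits p (a :: l) = (p a).toNat + 2 * bits p l := by
  have h : bits p (a :: l) = (Bool.rec 0 1 (p a) : ℕ) + 2 * bits p l := rfl
  rw [h]
  cases p a <;> rfl

theorem bits_lt (p : ℕ → Bool) (l : List ℕ) : bits p l < 2 ^ l.length := by
  induction l with
  | nil => simp [bits]
  | cons a l ih =>
    rw [bits_cons, List.length_cons, pow_succ]
    have := Bool.toNat_le (p a)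
    omega

theorem testBit_bits (p : ℕ → Bool) (l : List ℕ) (i : ℕ) (hi : i < l.length) :
    (bits p l).testBit i = p l[i] := by
  induction l generalizing i with
  | nil => simp at hi
  | cons a l ih =>
    rw [bits_cons, add_comm]
    have h1 : (p a).toNat < 2 ^ 1 := by have := Bool.toNat_le (p a); omega
    have := Nat.testBit_two_pow_mul_add (bits p l) h1 i
    rw [pow_one] at this
    rw [this]
    cases i with
    | zero => cases h : p a <;> simp [h]
    | succ i => simpa using ih i (by simpa using hi)

/-- The number whose `i`-th block of `w` bits is the image under `g` of the `i`-th entry. -/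
noncomputable def rows (w : ℕ) (g : ℕ → ℕ) (l : List ℕ) : ℕ :=
  List.rec 0 (fun a _ ih => Nat.add (g a) (Nat.mul (Nat.pow 2 w) ih)) l

theorem rows_cons (w : ℕ) (g : ℕ → ℕ) (a : ℕ) (l : List ℕ) :
    rows w g (a :: l) = 2 ^ w * rows w g l + g a := by
  rw [add_comm]; rfl

theorem testBit_rows {w : ℕ} {g : ℕ → ℕ} (hg : ∀ a, g a < 2 ^ w) (l : List ℕ) (i j : ℕ)
    (hi : i < l.length) (hj : j < w) : (rows w g l).testBit (w * i + j) = (g l[i]).testBit j := by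
  induction l generalizing i with
  | nil => simp at hi
  | cons a l ih =>
    rw [rows_cons, Nat.testBit_two_pow_mul_add _ (hg a)]
    cases i with
    | zero => simp [hj]
    | succ i =>
      have : ¬ w * (i + 1) + j < w := by rw [mul_add]; omega
      rw [if_neg this]
      have h2 : w * (i + 1) + j - w = w * i + j := by rw [mul_add]; omega
      rw [h2]
      simpa using ih i (by simpa using hi)

/-! ### The search -/

/-- `k n`, arranged so that the kernel evaluates `n` first. -/
noncomputable def force {α : Type} (n : ℕ) (k : ℕ → α) : α :=
  Nat.rec (motive := fun _ => α) (k 0) (fun m _ => k (Nat.succ m)) n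

/-- Conjunction, evaluated lazily by the kernel. -/
noncomputable def both (a b : Bool) : Bool := Bool.rec false b a

/-- Disjunction, evaluated lazily by the kernel. -/
noncomputable def either (a b : Bool) : Bool := Bool.rec b true a

/-- Implication, evaluated lazily by the kernel. -/
noncomputable def implies (a b : Bool) : Bool := Bool.rec true b a

/-- Checks the lower `h` bits of `D` and the remaining ones separately. -/
noncomputable def splitBits (k : ℕ → ℕ → Bool) (lo D h : ℕ) : Bool :=
  both (force (Nat.shiftRight D h) (force (Nat.add lo h) k)) (force (Nat.mod D (Nat.pow 2 h)) (k lo))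

/-- One step of the recursion in `forBits`. -/
noncomputable def forBitsStep (n : ℕ) (ih : ℕ → ℕ → Bool) (lo D : ℕ) : Bool :=
  either (Nat.beq D 0) (force (Nat.pow 2 n) (splitBits ih lo D))

/-- Checks `k (lo + c)` for all `c` for which the bit `c` of `D` is set. -/
noncomputable def forBits (k : ℕ → Bool) (n : ℕ) : ℕ → ℕ → Bool :=
  Nat.rec (motive := fun _ => ℕ → ℕ → Bool) (fun lo D => either (Nat.beq D 0) (k lo)) forBitsStep n

/-- The codes of minimum distance 3 in the ternary space of dimension 3, as sets of words, ordered
by size. The word `(x, y, z)` has the number `9 * x + 3 * y + z`. -/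
def codeMasks : List ℕ :=
    [0, 1, 2, 4, 8, 16, 32, 64, 128, 256, 512, 1024, 2048, 4096, 8192, 16384, 32768, 65536,
     131072, 262144, 524288, 1048576, 2097152, 4194304, 8388608, 16777216, 33554432, 67108864,
     8193, 16385, 65537, 131073, 4194305, 8388609, 33554433, 67108865, 4098, 16386, 32770,
     131074, 2097154, 8388610, 16777218, 67108866, 4100, 8196, 32772, 65540, 2097156, 4194308,
     16777220, 33554436, 1032, 2056, 65544, 131080, 524296, 1048584, 33554440, 67108872, 528,
     2064, 32784, 131088, 262160, 1048592, 16777232, 67108880, 544, 1056, 32800, 65568, 262176,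
     524320, 16777248, 33554464, 1088, 2112, 8256, 16448, 524352, 1048640, 4194368, 8388672,
     640, 2176, 4224, 16512, 262272, 1048704, 2097280, 8388736, 768, 1280, 4352, 8448, 262400,
     524544, 2097408, 4194560, 4194816, 8389120, 33554944, 67109376, 2098176, 8389632, 16778240,
     67109888, 2099200, 4196352, 16779264, 33556480, 528384, 1052672, 33558528, 67112960,
     270336, 1056768, 16785408, 67117056, 278528, 540672, 16793600, 33570816, 557056, 1081344,
     4227072, 8421376, 327680, 1114112, 2162688, 8454144, 393216, 655360, 2228224, 4325376,
     67117057, 33570817, 8454145, 4325377, 67112962, 16793602, 8421378, 2228226, 33558532,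
     16785412, 4227076, 2162692, 67109896, 33556488, 1114120, 655368, 67109392, 16779280,
     1081360, 393232, 33554976, 16778272, 557088, 327712, 8389696, 4196416, 1056832, 540736,
     8389248, 2099328, 1052800, 278656, 4195072, 2098432, 528640, 270592]

/-- The balls of radius 1 in the ternary space of dimension 3. -/
def balls : List ℕ :=
    [262735, 525463, 1050919, 2101369, 4202682, 8405308, 16810441, 33620434, 67240420, 302593,
     601602, 1199620, 2159112, 4289552, 8550432, 17011264, 33793152, 67356928, 20709889,
     39584770, 77334532, 31723528, 48766992, 82853920, 119832640, 122224768, 127009024]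

/-- The isometries of the ternary space of dimension 3 which permute the coordinates and may
exchange the symbols 0 and 1. -/
def symmetries : List (List ℕ) :=
  [[0, 1, 2, 3, 4, 5, 6, 7, 8, 9, 10, 11, 12, 13, 14, 15, 16, 17, 18, 19, 20, 21, 22, 23, 24,
     25, 26],
    [13, 12, 14, 10, 9, 11, 16, 15, 17, 4, 3, 5, 1, 0, 2, 7, 6, 8, 22, 21, 23, 19, 18, 20, 25,
     24, 26],
    [0, 3, 6, 1, 4, 7, 2, 5, 8, 9, 12, 15, 10, 13, 16, 11, 14, 17, 18, 21, 24, 19, 22, 25, 20,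
     23, 26],
    [13, 10, 16, 12, 9, 15, 14, 11, 17, 4, 1, 7, 3, 0, 6, 5, 2, 8, 22, 19, 25, 21, 18, 24, 23,
     20, 26],
    [0, 1, 2, 9, 10, 11, 18, 19, 20, 3, 4, 5, 12, 13, 14, 21, 22, 23, 6, 7, 8, 15, 16, 17, 24,
     25, 26],
    [13, 12, 14, 4, 3, 5, 22, 21, 23, 10, 9, 11, 1, 0, 2, 19, 18, 20, 16, 15, 17, 7, 6, 8, 25,
     24, 26],
    [0, 3, 6, 9, 12, 15, 18, 21, 24, 1, 4, 7, 10, 13, 16, 19, 22, 25, 2, 5, 8, 11, 14, 17, 20,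
     23, 26],
    [13, 10, 16, 4, 1, 7, 22, 19, 25, 12, 9, 15, 3, 0, 6, 21, 18, 24, 14, 11, 17, 5, 2, 8, 23,
     20, 26],
    [0, 9, 18, 1, 10, 19, 2, 11, 20, 3, 12, 21, 4, 13, 22, 5, 14, 23, 6, 15, 24, 7, 16, 25, 8,
     17, 26],
    [13, 4, 22, 12, 3, 21, 14, 5, 23, 10, 1, 19, 9, 0, 18, 11, 2, 20, 16, 7, 25, 15, 6, 24, 17,
     8, 26],
    [0, 9, 18, 3, 12, 21, 6, 15, 24, 1, 10, 19, 4, 13, 22, 7, 16, 25, 2, 11, 20, 5, 14, 23, 8,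
     17, 26],
    [13, 4, 22, 10, 1, 19, 16, 7, 25, 12, 3, 21, 9, 0, 18, 15, 6, 24, 14, 5, 23, 11, 2, 20, 17,
     8, 26]]

/-- The union of the sets from the list `l` whose index belongs to `m`. -/
noncomputable def unionOf (l : List ℕ) : ℕ → ℕ :=
  List.rec (motive := fun _ => ℕ → ℕ) (fun _ => 0)
    (fun a _ ih m => Nat.lor (Bool.rec 0 a (Nat.beq (Nat.mod m 2) 1)) (ih (Nat.div m 2))) l

/-- Row `c` tells which codes have distance at least 2 from the code `c`. -/
noncomputable def farTable : ℕ :=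
  rows 172 (fun m => force (unionOf balls m) fun b =>
    bits (fun m' => Nat.beq (Nat.land b m') 0) codeMasks) codeMasks

/-- Row `c` tells which codes are disjoint from the code `c`. -/
noncomputable def disjointTable : ℕ :=
  rows 172 (fun m => bits (fun m' => Nat.beq (Nat.land m m') 0) codeMasks) codeMasks

/-- One of three values, according to whether the binary words `u` and `v` have distance 1, 2, or
at least 3; and 0 if they are equal. -/
noncomputable def byDist (x₁ x₂ x₃ : ℕ) (v u : ℕ) : ℕ :=
  -- The set bits of 278 are 1, 2, 4, 8 and those of 5736 are 3, 5, 6, 9, 10, 12: the numbers below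
  -- 16 of weight 1 and 2.
  Bool.rec (Bool.rec (Bool.rec x₃ 0 (Nat.beq (Nat.xor u v) 0)) x₂ (Nat.testBit 5736 (Nat.xor u v)))
    x₁ (Nat.testBit 278 (Nat.xor u v))

/-- The number whose block `v + 1` of 173 bits is `g v`, for `v < 16`. -/
noncomputable def state (g : ℕ → ℕ) : ℕ := Nat.mul (2 ^ 173) (pack 173 g 16)

/-- The number of words of the code `c`. -/
noncomputable def size (c : ℕ) : ℕ :=
  Bool.rec (Bool.rec (Bool.rec 0 1 (Nat.ble 1 c)) 2 (Nat.ble 28 c)) 3 (Nat.ble 136 c)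

/-- Added to a state, it sets the top bit of the blocks whose value is at least `t`. -/
noncomputable def atLeast (t : ℕ) : ℕ := state fun _ => 2 ^ 172 - t

/-- The top bits of all blocks. -/
noncomputable def guards : ℕ := state fun _ => 2 ^ 172

/-- The threshold for blocks that contain a code with at least one word. -/
noncomputable def atLeastOne : ℕ := atLeast (2 ^ 1)

/-- The threshold for blocks that contain a code with at least two words. -/
noncomputable def atLeastTwo : ℕ := atLeast (2 ^ 28)

/-- The threshold for blocks that contain a code with three words. -/
noncomputable def atLeastThree : ℕ := atLeast (2 ^ 136)

/-- The `k`-th hexadecimal digit of `U`. -/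
noncomputable def faceBound (U k : ℕ) : ℕ := Nat.mod (Nat.shiftRight U (Nat.mul 4 k)) 16

/-- The minimum of two numbers. -/
noncomputable def minNat (a b : ℕ) : ℕ := Bool.rec b a (Nat.ble a b)

/-- The condition `bound` in terms of upper bounds for the sizes of the four faces. -/
noncomputable def boundAux (s U : ℕ) : Bool :=
  -- If faces 0 and 3 have at most `s` words and face 2 at most as many as face 1, then 29 words
  -- force `29 ≤ 2 * s + 2 * f₁`, that is `f₁ ≥ 15 - s`.
  both (Nat.ble s (faceBound U 0)) <| both (Nat.ble (Nat.sub 15 s) (faceBound U 1)) <|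
    Nat.ble 29 (Nat.add (Nat.add (minNat (faceBound U 0) s) (minNat (faceBound U 1) s))
      (Nat.add (minNat (faceBound U 2) s) (minNat (faceBound U 3) s)))

/-- A necessary condition for the existence of a code of at least 29 words with domains `X`. -/
noncomputable def bound (s X : ℕ) : Bool :=
  -- The three masked sums add up to the largest available size of each vertex, stored at its guard
  -- bit. The shift by 345 = 173 + 172 moves these digits to base `2 ^ 173`. Reduction modulo `2 ^
  -- 692 - 1`, with 692 = 4 * 173, adds up the vertices of each face; reduction modulo `2 ^ 173 -
  -- 16` turns the base into 16.
  force (Nat.mod (Nat.mod (Nat.shiftRight (Nat.add (Nat.add (Nat.land (Nat.add X atLeastOne) guards)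
    (Nat.land (Nat.add X atLeastTwo) guards)) (Nat.land (Nat.add X atLeastThree) guards)) 345)
    (2 ^ 692 - 1)) (2 ^ 173 - 16)) (boundAux s)

/-- The tables of compatible codes for two vertices at distance 1 and 2, and the
multipliers that distribute the rows of these tables over the blocks of a state. -/
structure Multipliers where
  far : ℕ
  disj : ℕ
  shift : ℕ
  one : ℕ
  two : ℕ
  rest : ℕ

/-- The blocks of codes compatible with the choice of the code `c`; `r` is the offset of its row. -/
noncomputable def restriction (K : Multipliers) (c r : ℕ) : ℕ :=
  -- A product with a sum of block units copies a table row into all selected blocks at once. The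
  -- last summand leaves distant vertices free and keeps only `c` at the vertex itself.
  Nat.add (Nat.add (Nat.mul K.one (Nat.mod (Nat.shiftRight K.far r) (2 ^ 172)))
    (Nat.mul K.two (Nat.mod (Nat.shiftRight K.disj r) (2 ^ 172))))
    (Nat.add K.rest (Nat.pow 2 (Nat.add K.shift c)))

/-- Continues with the state `X` unless the bound excludes it. -/
noncomputable def continueSearch (s : ℕ) (ih : ℕ → Bool) (X : ℕ) : Bool :=
  implies (bound s X) (ih X)

/-- Restricts the state `X` by the choice of the code `c`. The lowest block is a label which keeps
the low bits of different states distinct. -/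
noncomputable def assign (s : ℕ) (ih : ℕ → Bool) (K : Multipliers) (X c r : ℕ) : Bool :=
  force (Nat.add (Nat.mod (Nat.add (Nat.mul X 256) c) (2 ^ 64))
    (Nat.land X (restriction K c r))) (continueSearch s ih)

/-- Explores the choice of the code `c`, unless the condition `chk` excludes it. -/
noncomputable def branch (s : ℕ) (chk : List ℕ → Bool) (ih : List ℕ → ℕ → Bool) (acc : List ℕ)
    (X : ℕ) (K : Multipliers) (c : ℕ) : Bool :=
  either (chk (List.cons c acc)) (force (Nat.mul 172 c) (assign s (ih (List.cons c acc)) K X c))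

/-- Explores all codes which the state `X` admits at the current vertex. -/
noncomputable def visit (s : ℕ) (chk : List ℕ → Bool) (ih : List ℕ → ℕ → Bool) (acc : List ℕ)
    (X : ℕ) (K : Multipliers) : Bool :=
  force (Nat.mod (Nat.shiftRight X K.shift) (2 ^ 172))
    (forBits (branch s chk ih acc X K) 8 0)

/-- Computes the multipliers of the vertex `v`. -/
noncomputable def withMultipliers (t₁ t₂ v : ℕ) (k : Multipliers → Bool) : Bool :=
  force (Nat.mul 173 (Nat.succ v)) fun sh =>
  force (state (byDist 1 0 0 v)) fun K₁ =>
  force (state (byDist 0 1 0 v)) fun K₂ =>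
  force (state (byDist 0 0 (2 ^ 172 - 1) v)) fun K₃ => k ⟨t₁, t₂, sh, K₁, K₂, K₃⟩

/-- Depth-first search over the vertices of a list, with further conditions on the
codes chosen so far. -/
noncomputable def search (s t₁ t₂ : ℕ) (l : List (ℕ × (List ℕ → Bool))) : List ℕ → ℕ → Bool :=
  -- Reaching the end of the list means that a family was found, so the value there is `false`.
  List.rec (motive := fun _ => List ℕ → ℕ → Bool) (fun _ _ => false)
    (fun p _ ih acc X => withMultipliers t₁ t₂ p.1 (visit s p.2 ih acc X)) l

/-- The preimage of the set `m` under the map with the values `l`. -/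
noncomputable def pull (l : List ℕ) (m : ℕ) : ℕ := bits (Nat.testBit m) l

/-- The code with index `c`. -/
noncomputable def code (c : ℕ) : ℕ := codeMasks.getD c 0

/-- A symmetry increases the code at the vertex 12. -/
noncomputable def exceeded₁ : List ℕ → Bool
  | [a, _] => symmetries.any fun g => Nat.blt (code a) (pull g (code a))
  | _ => false

/-- A symmetry that fixes the code at the vertex 12 increases the one at the vertex 4. -/
noncomputable def exceeded₂ : List ℕ → Bool
  | [b, a, _] => symmetries.any fun g =>
      Nat.beq (code a) (pull g (code a)) && Nat.blt (code b) (pull g (code b))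
  | _ => false

/-- The code at the vertex 8 exceeds the one at the vertex 4, or the face 0 is too large. -/
noncomputable def large₀ (s : ℕ) : List ℕ → Bool
  | [c, b, a, o] => Nat.blt (code b) (code c) || Nat.blt s (size o + size a + size b + size c)
  | _ => false

/-- The face 1 has more than `s` words. -/
noncomputable def large₁ (s : ℕ) : List ℕ → Bool
  | c :: b :: a :: o :: _ => Nat.blt s (size o + size a + size b + size c)
  | _ => false

/-- The face 2 has more words than the face 1. -/
noncomputable def large₂ : List ℕ → Bool
  | c :: b :: a :: o :: c' :: b' :: a' :: o' :: _ =>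
      Nat.blt (size o' + size a' + size b' + size c') (size o + size a + size b + size c)
  | _ => false

/-- The vertices in the order of the search, with the conditions checked there. -/
noncomputable def levels (s : ℕ) : List (ℕ × (List ℕ → Bool)) :=
  -- Within a face the opposite vertex comes second. In face 0, exchanging the two high coordinates
  -- fixes 0 and 12 and swaps 4 with 8, which justifies ordering the sets at 4 and 8.
  [(0, fun _ => false), (12, exceeded₁), (4, exceeded₂), (8, large₀ s),
   (1, fun _ => false), (13, fun _ => false), (5, fun _ => false), (9, large₁ s),
   (2, fun _ => false), (14, fun _ => false), (6, fun _ => false), (10, large₂),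
   (3, fun _ => false), (15, fun _ => false), (7, fun _ => false), (11, fun _ => false)]

/-- The state in which the code at vertex 0 is `c` and those at the other vertices of its face
have indices in `D`. -/
noncomputable def start (c D : ℕ) : ℕ :=
  state fun v => Bool.rec (Bool.rec (2 ^ 172 - 1) D (Nat.beq (Nat.mod v 4) 0))
    (Nat.pow 2 c) (Nat.beq v 0)

/-- The search for a code with first set `c`; the value is `true` if there is none. -/
noncomputable def searchFrom (s c D : ℕ) : Bool :=
  force farTable fun t₁ => force disjointTable fun t₂ =>
    force (start c D) (search s t₁ t₂ (levels s) [])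

/-! ### The three computations -/

set_option maxRecDepth 100000 in
theorem searchFrom_triple_eight : searchFrom 8 136 (2 ^ 172 - 1) = true := by decide +kernel

set_option maxRecDepth 100000 in
theorem searchFrom_triple_of_nine_le :
    ∀ s ∈ [9, 10, 11, 12], searchFrom s 136 (2 ^ 172 - 1) = true := by decide +kernel

-- The set bits of `2 ^ 136 - 2 ^ 28` are the indices 28 to 135, the pairs: this is the case of face
-- 0 without triples.
set_option maxRecDepth 100000 in
theorem searchFrom_pair_eight : searchFrom 8 28 (2 ^ 136 - 2 ^ 28) = true := by decide +kernel

/-! ### Correctness of the propagation step -/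

@[simp] theorem force_eq {α : Type} (n : ℕ) (k : ℕ → α) : force n k = k n := by cases n <;> rfl

@[simp] theorem both_eq (a b : Bool) : both a b = (a && b) := by cases a <;> rfl

@[simp] theorem either_eq (a b : Bool) : either a b = (a || b) := by cases a <;> rfl

@[simp] theorem implies_true (b : Bool) : implies true b = b := rfl

theorem forBits_spec {k : ℕ → Bool} {n lo D c : ℕ} (h : forBits k n lo D = true) (hc : c < 2 ^ n)
    (hD : D.testBit c = true) : k (lo + c) = true := by
  induction n generalizing lo D c with
  | zero =>
    have h' : either (Nat.beq D 0) (k lo) = true := h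
    obtain rfl : c = 0 := by simpa using hc
    have hD0 : Nat.beq D 0 = false := by
      cases D with
      | zero => simp at hD
      | succ n => rfl
    simpa [hD0] using h'
  | succ n ih =>
    have h' : either (Nat.beq D 0) (force (2 ^ n) (splitBits (forBits k n) lo D)) = true := h
    have hD0 : Nat.beq D 0 = false := by
      cases D with
      | zero => simp at hD
      | succ n => rfl
    have h2 : splitBits (forBits k n) lo D (2 ^ n) = true := by simpa [hD0] using h'
    have h3 : forBits k n (lo + 2 ^ n) (D >>> 2 ^ n) = true ∧
        forBits k n lo (D % 2 ^ 2 ^ n) = true := by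
      have h4 : both (force (D >>> 2 ^ n) (force (lo + 2 ^ n) (forBits k n)))
        (force (D % 2 ^ 2 ^ n) (forBits k n lo)) = true := h2
      simpa using h4
    rcases lt_or_ge c (2 ^ n) with hlt | hge
    · exact ih h3.2 hlt (by simp [Nat.testBit_mod_two_pow, hlt, hD])
    · have := ih (c := c - 2 ^ n) h3.1 (by rw [pow_succ] at hc; omega)
        (by rw [Nat.testBit_shiftRight, Nat.add_sub_cancel' hge]; exact hD)
      rwa [add_assoc, Nat.add_sub_cancel' hge] at this

theorem state_eq (g : ℕ → ℕ) : state g = 2 ^ 173 * pack 173 g 16 := rfl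

theorem state_add (g h : ℕ → ℕ) : state g + state h = state fun u => g u + h u := by
  rw [state_eq, state_eq, state_eq, ← mul_add, pack_eq_sum, pack_eq_sum, pack_eq_sum,
    ← Finset.sum_add_distrib]
  exact congrArg _ (Finset.sum_congr rfl fun u _ => (add_mul _ _ _).symm)

theorem state_mul (g : ℕ → ℕ) (r : ℕ) : state g * r = state fun u => g u * r := by
  rw [state_eq, state_eq, mul_assoc, pack_eq_sum, pack_eq_sum, Finset.sum_mul]
  exact congrArg _ (Finset.sum_congr rfl fun u _ => mul_right_comm _ _ _)

theorem two_pow_eq_state {v : ℕ} (hv : v < 16) (c : ℕ) :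
    2 ^ (173 * (v + 1) + c) = state fun u => if u = v then 2 ^ c else 0 := by
  rw [state_eq, pack_eq_sum, Finset.sum_eq_single v]
  · rw [if_pos rfl, ← pow_add, ← pow_add, mul_add, mul_one]
    exact congrArg _ (by omega)
  · intro u _ hu; simp [hu]
  · intro h; simp [hv] at h

theorem testBit_state {g : ℕ → ℕ} (hg : ∀ u < 16, g u < 2 ^ 173) {u j : ℕ} (hu : u < 16)
    (hj : j < 173) : (state g).testBit (173 * (u + 1) + j) = (g u).testBit j := by
  have h := Nat.testBit_two_pow_mul_add (i := 173) (b := 0) (pack 173 g 16) (by positivity)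
    (173 * (u + 1) + j)
  rw [add_zero] at h
  have e : 173 * (u + 1) + j - 173 = 173 * u + j := by omega
  rw [state_eq, h, if_neg (by omega), e, testBit_pack hg hu hj]

/-- The indices `f u` of the codes at the vertices `u < 16` are in the domains given by `X`. -/
structure Fits (f : ℕ → ℕ) (X : ℕ) : Prop where
  lt : X < 2 ^ (173 * 17)
  mem : ∀ u < 16, X.testBit (173 * (u + 1) + f u) = true
  guard : ∀ u < 16, X.testBit (173 * (u + 1) + 172) = false

/-- Number of ones of a binary word of length 4. -/
def weight (x : ℕ) : ℕ := x % 2 + x / 2 % 2 + x / 4 % 2 + x / 8 % 2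

/-- The codes with the indices `f u` are compatible according to the tables. -/
structure Compatible (t₁ t₂ : ℕ) (f : ℕ → ℕ) : Prop where
  lt : ∀ u < 16, f u < 172
  far : ∀ u < 16, ∀ v < 16, weight (u ^^^ v) = 1 → t₁.testBit (172 * f v + f u) = true
  disj : ∀ u < 16, ∀ v < 16, weight (u ^^^ v) = 2 → t₂.testBit (172 * f v + f u) = true

theorem byDist_eq {u v : ℕ} (hu : u < 16) (hv : v < 16) (x₁ x₂ x₃ : ℕ) :
    byDist x₁ x₂ x₃ v u = if weight (u ^^^ v) = 1 then x₁ else if weight (u ^^^ v) = 2 then x₂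
      else if u = v then 0 else x₃ := by
  have key : ∀ u < 16, ∀ v < 16, (Nat.testBit 278 (Nat.xor u v) = decide (weight (u ^^^ v) = 1)) ∧
      (Nat.testBit 5736 (Nat.xor u v) = decide (weight (u ^^^ v) = 2)) ∧
      (Nat.beq (Nat.xor u v) 0 = decide (u = v)) := by decide +kernel
  obtain ⟨h1, h2, h3⟩ := key u hu v hv
  unfold byDist
  rw [h1, h2, h3]
  by_cases a1 : weight (u ^^^ v) = 1
  · simp [a1]
  by_cases a2 : weight (u ^^^ v) = 2
  · simp [a2]
  by_cases a3 : u = v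
  · simp [a3, weight]
  · simp [a1, a2, a3]

/-- The multipliers belonging to the vertex `v`. -/
noncomputable def multipliers (t₁ t₂ v : ℕ) : Multipliers :=
  ⟨t₁, t₂, 173 * (v + 1), state (byDist 1 0 0 v), state (byDist 0 1 0 v),
    state (byDist 0 0 (2 ^ 172 - 1) v)⟩

theorem withMultipliers_eq (t₁ t₂ v : ℕ) (k : Multipliers → Bool) :
    withMultipliers t₁ t₂ v k = k (multipliers t₁ t₂ v) := by
  unfold withMultipliers
  simp only [force_eq]
  rfl

theorem restriction_def (K : Multipliers) (c r : ℕ) :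
    restriction K c r = K.one * (K.far >>> r % 2 ^ 172) + K.two * (K.disj >>> r % 2 ^ 172) +
      (K.rest + 2 ^ (K.shift + c)) := rfl

theorem restriction_eq {t₁ t₂ v c : ℕ} (hv : v < 16) :
    restriction (multipliers t₁ t₂ v) c (172 * c) = state fun u =>
      byDist 1 0 0 v u * (t₁ / 2 ^ (172 * c) % 2 ^ 172) +
      byDist 0 1 0 v u * (t₂ / 2 ^ (172 * c) % 2 ^ 172) +
      (byDist 0 0 (2 ^ 172 - 1) v u + if u = v then 2 ^ c else 0) := by
  rw [restriction_def]
  simp only [multipliers]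
  rw [two_pow_eq_state hv, state_mul, state_mul, state_add, state_add, state_add,
    Nat.shiftRight_eq_div_pow, Nat.shiftRight_eq_div_pow]

/-- Propagation is sound: compatibility puts the bit `f u` into every block of the restriction, so
intersecting with it keeps `f`. The label `t` only affects the lowest block. -/
theorem Fits.next {f : ℕ → ℕ} {X t t₁ t₂ v : ℕ} (hX : Fits f X) (hf : Compatible t₁ t₂ f)
    (hv : v < 16) (ht : t < 2 ^ 64) :
    Fits f (t + (X &&& restriction (multipliers t₁ t₂ v) (f v) (172 * f v))) := by
  rw [restriction_eq hv]
  set g : ℕ → ℕ := fun u =>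
      byDist 1 0 0 v u * (t₁ / 2 ^ (172 * f v) % 2 ^ 172) +
      byDist 0 1 0 v u * (t₂ / 2 ^ (172 * f v) % 2 ^ 172) +
      (byDist 0 0 (2 ^ 172 - 1) v u + if u = v then 2 ^ f v else 0) with hg
  -- For each `u` exactly one summand survives, so every block stays below `2 ^ 172` and nothing
  -- carries into the next one.
  have hval : ∀ u < 16, g u < 2 ^ 172 ∧ (g u).testBit (f u) = true := by
    intro u hu
    have hu' := hf.lt u hu
    have hbit : ∀ T : ℕ, T.testBit (172 * f v + f u) = true →
        (T / 2 ^ (172 * f v) % 2 ^ 172).testBit (f u) = true := by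
      intro T hT
      rw [Nat.testBit_mod_two_pow, Nat.testBit_div_two_pow, add_comm (f u), hT, decide_eq_true hu']
      rfl
    have hm : ∀ a : ℕ, a % 2 ^ 172 < 2 ^ 172 := fun a => Nat.mod_lt _ (by positivity)
    simp only [hg, byDist_eq hu hv]
    by_cases a1 : weight (u ^^^ v) = 1
    · have huv : u ≠ v := by rintro rfl; simp [weight] at a1
      simp only [a1, huv, if_true, if_false, one_mul, zero_mul, add_zero]
      exact ⟨hm _, hbit _ (hf.far u hu v hv a1)⟩
    by_cases a2 : weight (u ^^^ v) = 2
    · have huv : u ≠ v := by rintro rfl; simp [weight] at a2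
      simp only [a2, huv, if_true, if_false, one_mul, zero_mul, add_zero, zero_add,
        show ¬ (2 = 1) by decide]
      exact ⟨hm _, hbit _ (hf.disj u hu v hv a2)⟩
    by_cases a3 : u = v
    · subst a3
      have hw : weight (u ^^^ u) = 0 := by simp [weight]
      simp only [hw, if_true, zero_mul, add_zero, zero_add, show ¬ (0 = 1) by decide,
        show ¬ (0 = 2) by decide, if_false]
      exact ⟨Nat.pow_lt_pow_right (by norm_num) hu', by simp⟩
    · simp only [a1, a2, a3, if_false, zero_mul, add_zero, zero_add]
      exact ⟨by norm_num, by rw [Nat.testBit_two_pow_sub_one]; simpa using hu'⟩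
  have hg173 : ∀ u < 16, g u < 2 ^ 173 := fun u hu =>
    (hval u hu).1.trans (Nat.pow_lt_pow_right (by norm_num) (by norm_num))
  -- Block 0 of a `state` is empty, so adding `t` causes no carry.
  have hdvd : 2 ^ 173 ∣ (X &&& state g) := by
    rw [Nat.dvd_iff_mod_eq_zero, Nat.and_mod_two_pow, state_eq, Nat.mul_mod_right, Nat.and_zero]
  obtain ⟨A, hA⟩ := hdvd
  have ht' : t < 2 ^ 173 := ht.trans (Nat.pow_lt_pow_right (by norm_num) (by norm_num))
  have hbits : ∀ i, 173 ≤ i → (t + (X &&& state g)).testBit i = (X &&& state g).testBit i := by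
    intro i hi
    have h0 := Nat.testBit_two_pow_mul_add (b := 0) A (show 0 < 2 ^ 173 by positivity) i
    rw [add_zero] at h0
    rw [hA, add_comm, Nat.testBit_two_pow_mul_add A ht', h0]
    simp [not_lt.2 hi]
  refine ⟨?_, fun u hu => ?_, fun u hu => ?_⟩
  · have h1 : X &&& state g < 2 ^ (173 * 17) := Nat.and_le_left.trans_lt hX.lt
    have e : 2 ^ (173 * 17) = 2 ^ 173 * 2 ^ (173 * 16) := by rw [← pow_add]
    rw [hA] at h1 ⊢
    rw [e] at h1 ⊢
    have h2 : A + 1 ≤ 2 ^ (173 * 16) := Nat.lt_of_mul_lt_mul_left h1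
    calc t + 2 ^ 173 * A < 2 ^ 173 * (A + 1) := by rw [mul_add]; omega
      _ ≤ _ := Nat.mul_le_mul_left _ h2
  · have := hf.lt u hu
    rw [hbits _ (by omega), Nat.testBit_and, hX.mem u hu,
      testBit_state hg173 hu (by omega), (hval u hu).2, Bool.and_self]
  · rw [hbits _ (by omega), Nat.testBit_and, hX.guard u hu, Bool.false_and]

/-! ### The counting bound -/

theorem ble_eq_decide (a b : ℕ) : Nat.ble a b = decide (a ≤ b) := by
  rw [Bool.eq_iff_iff, Nat.ble_eq, decide_eq_true_iff]

theorem size_eq (c : ℕ) : size c =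
    (if 1 ≤ c then 1 else 0) + (if 28 ≤ c then 1 else 0) + (if 136 ≤ c then 1 else 0) := by
  unfold size
  simp only [ble_eq_decide]
  by_cases h1 : 1 ≤ c <;> by_cases h2 : 28 ≤ c <;> by_cases h3 : 136 ≤ c <;>
    simp only [h1, h2, h3, decide_true, decide_false, if_true, if_false] <;> omega

theorem minNat_eq (a b : ℕ) : minNat a b = min a b := by
  unfold minNat
  rw [ble_eq_decide]
  by_cases h1 : a ≤ b
  · simp [h1]
  · simp [h1]; omega

theorem Fits.eq_state {f : ℕ → ℕ} {X : ℕ} (hX : Fits f X) :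
    X = 2 ^ 173 * pack 173 (fun u => X / 2 ^ (173 * (u + 1)) % 2 ^ 173) 16 + X % 2 ^ 173 := by
  have h1 : X / 2 ^ 173 < 2 ^ (173 * 16) := by
    rw [Nat.div_lt_iff_lt_mul (by positivity), ← pow_add]
    exact hX.lt
  have h2 := pack_digits 16 h1
  have h3 : pack 173 (fun u => X / 2 ^ 173 / 2 ^ (173 * u) % 2 ^ 173) 16 =
      pack 173 (fun u => X / 2 ^ (173 * (u + 1)) % 2 ^ 173) 16 :=
    pack_congr fun u _ => by
      rw [Nat.div_div_eq_div_mul, ← pow_add, mul_add, mul_one, add_comm 173]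
  rw [← h3, ← h2, Nat.div_add_mod]

theorem land_guard {a : ℕ} (ha : a < 2 ^ 173) :
    a &&& 2 ^ 172 = if 2 ^ 172 ≤ a then 2 ^ 172 else 0 := by
  rw [Nat.and_two_pow]
  split_ifs with h
  · rw [Nat.testBit_of_two_pow_le_and_two_pow_add_one_gt h ha]
    simp
  · rw [Nat.testBit_lt_two_pow (not_le.1 h)]
    simp

theorem Fits.digit_lt {f : ℕ → ℕ} {X u : ℕ} (hX : Fits f X) (hu : u < 16) :
    X / 2 ^ (173 * (u + 1)) % 2 ^ 173 < 2 ^ 172 := by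
  refine Nat.lt_pow_two_of_testBit _ fun i hi => ?_
  rw [Nat.testBit_mod_two_pow, Nat.testBit_div_two_pow]
  rcases Nat.eq_or_lt_of_le hi with rfl | h
  · rw [add_comm, hX.guard u hu, Bool.and_false]
  · rw [decide_eq_false (by omega), Bool.false_and]

theorem Fits.le_digit {f : ℕ → ℕ} {X u e : ℕ} (hX : Fits f X) (hu : u < 16) (hf : f u < 172)
    (he : e ≤ f u) : 2 ^ e ≤ X / 2 ^ (173 * (u + 1)) % 2 ^ 173 := by
  refine (Nat.pow_le_pow_right (by norm_num) he).trans (Nat.ge_two_pow_of_testBit ?_)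
  rw [Nat.testBit_mod_two_pow, Nat.testBit_div_two_pow, decide_eq_true (by omega), add_comm,
    hX.mem u hu]
  rfl

/-- A block `D` is below `2 ^ 172`, so `D + (2 ^ 172 - t)` stays below `2 ^ 173` and has its top bit
set exactly when `t ≤ D`. All blocks are thus compared with `t` by a single addition. -/
theorem Fits.land_guards {f : ℕ → ℕ} {X t : ℕ} (hX : Fits f X) (h0 : 0 < t) (ht : t ≤ 2 ^ 172) :
    (X + atLeast t) &&& guards =
      state fun u => 2 ^ 172 * if t ≤ X / 2 ^ (173 * (u + 1)) % 2 ^ 173 then 1 else 0 := by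
  set D : ℕ → ℕ := fun u => X / 2 ^ (173 * (u + 1)) % 2 ^ 173 with hD
  have hDlt : ∀ u < 16, D u < 2 ^ 172 := fun u hu => hX.digit_lt hu
  have h1 : X + atLeast t = 2 ^ 173 * pack 173 (fun u => D u + (2 ^ 172 - t)) 16 + X % 2 ^ 173 := by
    have h2 : atLeast t = state fun _ => 2 ^ 172 - t := rfl
    have h3 := state_add D fun _ => 2 ^ 172 - t
    rw [state_eq D, state_eq fun u => D u + (2 ^ 172 - t)] at h3
    rw [← h3, h2, add_right_comm, ← hX.eq_state]
  have h4 : guards = 2 ^ 173 * pack 173 (fun _ => 2 ^ 172) 16 + 0 := rfl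
  have h5 : (2 : ℕ) ^ 173 = 2 ^ 172 + 2 ^ 172 := by norm_num
  have hlt : ∀ u < 16, D u + (2 ^ 172 - t) < 2 ^ 173 := fun u hu => by
    have := hDlt u hu
    omega
  rw [h1, h4, land_two_pow_mul_add (Nat.mod_lt _ (by positivity)) (by positivity), Nat.and_zero,
    add_zero, land_pack hlt fun _ _ => Nat.pow_lt_pow_right (by norm_num) (by norm_num), state_eq]
  refine congrArg _ (pack_congr fun u hu => ?_)
  rw [land_guard (hlt u hu)]
  have h6 : 2 ^ 172 ≤ D u + (2 ^ 172 - t) ↔ t ≤ D u := by omega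
  simp only [h6]
  change _ = 2 ^ 172 * if t ≤ D u then 1 else 0
  split_ifs <;> simp

/-- `B ^ 4 ≡ 1` modulo `B ^ 4 - 1` merges the digits whose positions agree modulo 4, and `B ≡ 16`
modulo `B - 16` changes the base. The merged digits are at most 12, so both reduced values are
smaller than the moduli and are the actual remainders. -/
theorem sum_digits_mod {B : ℕ} (hB : 2 ^ 20 ≤ B) {z : ℕ → ℕ} (hz : ∀ u, z u ≤ 3) :
    (∑ u ∈ Finset.range 16, z u * B ^ u) % (B ^ 4 - 1) % (B - 16) =
      (z 0 + z 4 + z 8 + z 12) + 16 * (z 1 + z 5 + z 9 + z 13) +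
      256 * (z 2 + z 6 + z 10 + z 14) + 4096 * (z 3 + z 7 + z 11 + z 15) := by
  -- With `B = 16 + N` and `B ^ 4 = 1 + M` the moduli are `N` and `M`, and both congruences become
  -- polynomial identities without subtraction.
  obtain ⟨N, rfl⟩ := Nat.exists_eq_add_of_le (show 16 ≤ B by omega)
  obtain ⟨M, hM⟩ := Nat.exists_eq_add_of_le (show 1 ≤ (16 + N) ^ 4 from Nat.one_le_pow _ _ (by omega))
  set w₀ := z 0 + z 4 + z 8 + z 12 with h0
  set w₁ := z 1 + z 5 + z 9 + z 13 with h1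
  set w₂ := z 2 + z 6 + z 10 + z 14 with h2
  set w₃ := z 3 + z 7 + z 11 + z 15 with h3
  have b0 : w₀ ≤ 12 := by have := hz 0; have := hz 4; have := hz 8; have := hz 12; omega
  have b1 : w₁ ≤ 12 := by have := hz 1; have := hz 5; have := hz 9; have := hz 13; omega
  have b2 : w₂ ≤ 12 := by have := hz 2; have := hz 6; have := hz 10; have := hz 14; omega
  have b3 : w₃ ≤ 12 := by have := hz 3; have := hz 7; have := hz 11; have := hz 15; omega
  set C := 16 + N with hC
  set P : ℕ → ℕ := fun j => z (4 * j) + z (4 * j + 1) * C + z (4 * j + 2) * C ^ 2 +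
    z (4 * j + 3) * C ^ 3 with hP
  have e1 : ∑ u ∈ Finset.range 16, z u * C ^ u =
      P 0 + C ^ 4 * (P 1 + C ^ 4 * (P 2 + C ^ 4 * P 3)) := by
    simp only [Finset.sum_range_succ, Finset.sum_range_zero, hP]
    ring
  have e2 : P 0 + C ^ 4 * (P 1 + C ^ 4 * (P 2 + C ^ 4 * P 3)) =
      (w₀ + w₁ * C + w₂ * C ^ 2 + w₃ * C ^ 3) +
        M * (P 1 + P 2 * (2 + M) + P 3 * (3 + 3 * M + M ^ 2)) := by
    have e : w₀ + w₁ * C + w₂ * C ^ 2 + w₃ * C ^ 3 = P 0 + P 1 + P 2 + P 3 := by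
      simp only [hP, h0, h1, h2, h3]; ring
    rw [e, hM]; ring
  have e3 : w₀ + w₁ * C + w₂ * C ^ 2 + w₃ * C ^ 3 < M := by
    have c1 : w₁ * C ≤ 12 * C := Nat.mul_le_mul_right _ b1
    have c2 : w₂ * C ^ 2 ≤ 12 * C ^ 2 := Nat.mul_le_mul_right _ b2
    have c3 : w₃ * C ^ 3 ≤ 12 * C ^ 3 := Nat.mul_le_mul_right _ b3
    have d2 : 2 ^ 20 * C ≤ C ^ 2 := by rw [pow_two]; exact Nat.mul_le_mul_right _ hB
    have d3 : 2 ^ 20 * C ^ 2 ≤ C ^ 3 := by rw [pow_succ' C 2]; exact Nat.mul_le_mul_right _ hB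
    have d4 : 2 ^ 20 * C ^ 3 ≤ C ^ 4 := by rw [pow_succ' C 3]; exact Nat.mul_le_mul_right _ hB
    omega
  have e4 : w₀ + w₁ * C + w₂ * C ^ 2 + w₃ * C ^ 3 =
      (w₀ + 16 * w₁ + 256 * w₂ + 4096 * w₃) +
        N * (w₁ + w₂ * (32 + N) + w₃ * (768 + 48 * N + N ^ 2)) := by
    rw [hC]; ring
  have e5 : C ^ 4 - 1 = M := by omega
  have e6 : C - 16 = N := by omega
  rw [e1, e2, e5, e6, Nat.add_mul_mod_self_left, Nat.mod_eq_of_lt e3, e4,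
    Nat.add_mul_mod_self_left, Nat.mod_eq_of_lt (by omega)]

/-- Number of words at the vertices of the `k`-th face. -/
noncomputable def faceSize (f : ℕ → ℕ) (k : ℕ) : ℕ :=
  size (f k) + size (f (k + 4)) + size (f (k + 8)) + size (f (k + 12))

theorem boundAux_eq_true {s w₀ w₁ w₂ w₃ : ℕ} (h0 : w₀ ≤ 12) (h1 : w₁ ≤ 12) (h2 : w₂ ≤ 12)
    (h3 : w₃ ≤ 12) (hs : s ≤ w₀) (hs' : 15 - s ≤ w₁)
    (H : 29 ≤ min w₀ s + min w₁ s + (min w₂ s + min w₃ s)) :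
    boundAux s (w₀ + 16 * w₁ + 256 * w₂ + 4096 * w₃) = true := by
  set U := w₀ + 16 * w₁ + 256 * w₂ + 4096 * w₃ with hU
  have hk : ∀ k, faceBound U k = U / 2 ^ (4 * k) % 16 := fun k => by
    rw [← Nat.shiftRight_eq_div_pow]; rfl
  have f0 : faceBound U 0 = w₀ := by rw [hk]; norm_num; omega
  have f1 : faceBound U 1 = w₁ := by rw [hk]; norm_num; omega
  have f2 : faceBound U 2 = w₂ := by rw [hk]; norm_num; omega
  have f3 : faceBound U 3 = w₃ := by rw [hk]; norm_num; omega
  unfold boundAux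
  simp only [f0, f1, f2, f3, minNat_eq, both_eq, Bool.and_eq_true]
  exact ⟨Nat.ble_eq_true_of_le hs, Nat.ble_eq_true_of_le hs', Nat.ble_eq_true_of_le H⟩

theorem bound_def (s X : ℕ) : bound s X = boundAux s ((((X + atLeastOne) &&& guards) +
    ((X + atLeastTwo) &&& guards) + ((X + atLeastThree) &&& guards)) >>> 345 %
    (2 ^ 692 - 1) % (2 ^ 173 - 16)) := by
  unfold bound
  rw [force_eq]
  exact rfl

theorem Fits.bound_eq_true {f : ℕ → ℕ} {X s : ℕ} (hX : Fits f X) (hf : ∀ u < 16, f u < 172)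
    (h0 : faceSize f 0 = s) (h1 : 15 - s ≤ faceSize f 1) (hs : ∀ k < 4, faceSize f k ≤ s)
    (H : 29 ≤ faceSize f 0 + faceSize f 1 + faceSize f 2 + faceSize f 3) : bound s X = true := by
  set D : ℕ → ℕ := fun u => X / 2 ^ (173 * (u + 1)) % 2 ^ 173 with hD
  set z : ℕ → ℕ := fun u => (if 2 ^ 1 ≤ D u then 1 else 0) + (if 2 ^ 28 ≤ D u then 1 else 0) +
    (if 2 ^ 136 ≤ D u then 1 else 0) with hz
  have hz3 : ∀ u, z u ≤ 3 := fun u => by simp only [hz]; split_ifs <;> omega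
  -- Sets are indexed by increasing size, sizes 1, 2, 3 beginning at 1, 28, 136. A block containing
  -- the bit `f u` is therefore at least the threshold belonging to the size of `f u`.
  have hsz : ∀ u < 16, size (f u) ≤ z u := fun u hu => by
    have key : ∀ e, (if e ≤ f u then 1 else 0) ≤ if 2 ^ e ≤ D u then 1 else 0 := fun e => by
      split_ifs with a b b
      · exact le_rfl
      · exact absurd (hX.le_digit hu (hf u hu) a) b
      · exact Nat.zero_le _
      · exact le_rfl
    rw [size_eq]
    exact add_le_add (add_le_add (key 1) (key 28)) (key 136)
  have e1 : ((X + atLeastOne) &&& guards) + ((X + atLeastTwo) &&& guards) +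
      ((X + atLeastThree) &&& guards) = 2 ^ 345 * ∑ u ∈ Finset.range 16, z u * (2 ^ 173) ^ u := by
    have a1 := hX.land_guards (t := 2 ^ 1) (by positivity) (by norm_num)
    have a2 := hX.land_guards (t := 2 ^ 28) (by positivity) (by norm_num)
    have a3 := hX.land_guards (t := 2 ^ 136) (by positivity) (by norm_num)
    have b1 : atLeastOne = atLeast (2 ^ 1) := rfl
    have b2 : atLeastTwo = atLeast (2 ^ 28) := rfl
    have b3 : atLeastThree = atLeast (2 ^ 136) := rfl
    rw [b1, b2, b3, a1, a2, a3, state_add, state_add, state_eq, pack_eq_sum, Finset.mul_sum,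
      Finset.mul_sum]
    refine Finset.sum_congr rfl fun u _ => ?_
    rw [← pow_mul, show (345 : ℕ) = 173 + 172 from rfl, pow_add, ← mul_add, ← mul_add]
    change 2 ^ 173 * (2 ^ 172 * z u * 2 ^ (173 * u)) = _
    ring
  have e3 : (2 : ℕ) ^ 692 = (2 ^ 173) ^ 4 := by rw [← pow_mul]
  rw [bound_def, e1, Nat.shiftRight_eq_div_pow, Nat.mul_div_cancel_left _ (by positivity), e3,
    sum_digits_mod (by norm_num) hz3]
  have s0 := hs 0 (by norm_num)
  have s1 := hs 1 (by norm_num)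
  have s2 := hs 2 (by norm_num)
  have s3 := hs 3 (by norm_num)
  simp only [faceSize, Nat.zero_add, Nat.reduceAdd] at h0 h1 H s0 s1 s2 s3
  have hz' := fun u => hz3 u
  have i0 := hsz 0 (by norm_num); have i1 := hsz 1 (by norm_num); have i2 := hsz 2 (by norm_num)
  have i3 := hsz 3 (by norm_num); have i4 := hsz 4 (by norm_num); have i5 := hsz 5 (by norm_num)
  have i6 := hsz 6 (by norm_num); have i7 := hsz 7 (by norm_num); have i8 := hsz 8 (by norm_num)
  have i9 := hsz 9 (by norm_num); have i10 := hsz 10 (by norm_num)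
  have i11 := hsz 11 (by norm_num); have i12 := hsz 12 (by norm_num)
  have i13 := hsz 13 (by norm_num); have i14 := hsz 14 (by norm_num)
  have i15 := hsz 15 (by norm_num)
  have j0 := hz3 0; have j1 := hz3 1; have j2 := hz3 2; have j3 := hz3 3; have j4 := hz3 4
  have j5 := hz3 5; have j6 := hz3 6; have j7 := hz3 7; have j8 := hz3 8; have j9 := hz3 9
  have j10 := hz3 10; have j11 := hz3 11; have j12 := hz3 12; have j13 := hz3 13
  have j14 := hz3 14; have j15 := hz3 15
  clear_value z
  exact boundAux_eq_true (by omega) (by omega) (by omega) (by omega) (by omega) (by omega)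
    (by omega)

/-! ### A genuine code defeats the search -/

theorem visit_def (s : ℕ) (chk : List ℕ → Bool) (ih : List ℕ → ℕ → Bool) (acc : List ℕ) (X : ℕ)
    (K : Multipliers) : visit s chk ih acc X K =
      forBits (branch s chk ih acc X K) 8 0 (X >>> K.shift % 2 ^ 172) := by
  unfold visit
  rw [force_eq]
  exact rfl

theorem assign_def (s : ℕ) (ih : ℕ → Bool) (K : Multipliers) (X c r : ℕ) : assign s ih K X c r =
    continueSearch s ih ((X * 256 + c) % 2 ^ 64 + (X &&& restriction K c r)) := by
  unfold assign
  rw [force_eq]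
  exact rfl

theorem search_cons (s t₁ t₂ : ℕ) (p : ℕ × (List ℕ → Bool)) (l : List (ℕ × (List ℕ → Bool)))
    (acc : List ℕ) (X : ℕ) : search s t₁ t₂ (p :: l) acc X =
      withMultipliers t₁ t₂ p.1 (visit s p.2 (search s t₁ t₂ l) acc X) := rfl

theorem continueSearch_eq {s X : ℕ} {ih : ℕ → Bool} (h : bound s X = true) :
    continueSearch s ih X = ih X := by
  unfold continueSearch
  rw [h, implies_true]

theorem Fits.assign {f : ℕ → ℕ} {X t₁ t₂ v : ℕ} (hX : Fits f X) (hf : Compatible t₁ t₂ f)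
    (hv : v < 16) (a : ℕ) : Fits f (a % 2 ^ 64 +
      (X &&& restriction (multipliers t₁ t₂ v) (f v) (172 * f v))) := by
  have ha : a % 2 ^ 64 < 2 ^ 64 := Nat.mod_lt a (by positivity)
  exact hX.next hf hv ha

/-- The conditions attached to the vertices of the list `l` do not exclude `f`. -/
def Passes (f : ℕ → ℕ) : List (ℕ × (List ℕ → Bool)) → List ℕ → Prop
  | [], _ => True
  | p :: l, acc => p.2 (f p.1 :: acc) = false ∧ Passes f l (f p.1 :: acc)

/-- The branch that chooses `f` at every vertex is never pruned and reaches the final `false`, which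
falsifies every conjunction above it. -/
theorem search_eq_false {f : ℕ → ℕ} {s t₁ t₂ : ℕ} (hf : Compatible t₁ t₂ f)
    (hb : ∀ X, Fits f X → bound s X = true) (l : List (ℕ × (List ℕ → Bool)))
    (hl : ∀ p ∈ l, p.1 < 16) (acc : List ℕ) (X : ℕ) (hX : Fits f X) (hp : Passes f l acc) :
    search s t₁ t₂ l acc X = false := by
  induction l generalizing acc X with
  | nil => rfl
  | cons p l ih =>
    rw [Bool.eq_false_iff]
    intro h
    have hv : p.1 < 16 := hl p (by simp)
    rw [search_cons, withMultipliers_eq, visit_def] at h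
    have hlt := hf.lt p.1 hv
    have h3 := forBits_spec h (c := f p.1) (by omega) (by
      rw [show (multipliers t₁ t₂ p.1).shift = 173 * (p.1 + 1) from rfl,
        Nat.testBit_mod_two_pow, Nat.testBit_shiftRight, hX.mem p.1 hv, decide_eq_true hlt]
      rfl)
    rw [zero_add] at h3
    unfold branch at h3
    rw [either_eq, hp.1, Bool.false_or, force_eq] at h3
    change assign s (search s t₁ t₂ l (f p.1 :: acc)) (multipliers t₁ t₂ p.1) X (f p.1)
      (172 * f p.1) = true at h3
    rw [assign_def] at h3
    have hX' := hX.assign hf hv (X * 256 + f p.1)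
    have h4 : search s t₁ t₂ l (f p.1 :: acc) _ = false :=
      ih (fun q hq => hl q (by simp [hq])) _ _ hX' hp.2
    rw [continueSearch_eq (hb _ hX')] at h3
    exact Bool.false_ne_true (h4.symm.trans h3)

theorem fits_start {f : ℕ → ℕ} {c D : ℕ} (hf : ∀ u < 16, f u < 172) (h0 : f 0 = c)
    (hD : D < 2 ^ 172) (hD' : ∀ u < 16, u % 4 = 0 → u ≠ 0 → D.testBit (f u) = true) :
    Fits f (start c D) := by
  set g : ℕ → ℕ := fun v => if v = 0 then 2 ^ c else if v % 4 = 0 then D else 2 ^ 172 - 1 with hg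
  have h1 : start c D = state g := by
    unfold start
    congr 1
    funext v
    have b1 : Nat.beq v 0 = decide (v = 0) := by cases v <;> rfl
    have b2 : Nat.beq (Nat.mod v 4) 0 = decide (v % 4 = 0) := by
      change Nat.beq (v % 4) 0 = _
      cases v % 4 <;> rfl
    rw [b1, b2]
    simp only [hg]
    by_cases a : v = 0
    · simp [a]
    · by_cases b : v % 4 = 0
      · simp [a, b]
      · simp only [a, b, decide_false, if_false]
  have hval : ∀ u < 16, g u < 2 ^ 172 ∧ (g u).testBit (f u) = true := by
    intro u hu
    have := hf u hu
    simp only [hg]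
    split_ifs with a b
    · subst a; subst h0
      exact ⟨Nat.pow_lt_pow_right (by norm_num) this, by simp⟩
    · exact ⟨hD, hD' u hu b a⟩
    · exact ⟨by norm_num, by rw [Nat.testBit_two_pow_sub_one]; simpa using this⟩
  have hg173 : ∀ u < 16, g u < 2 ^ 173 := fun u hu =>
    (hval u hu).1.trans (Nat.pow_lt_pow_right (by norm_num) (by norm_num))
  rw [h1]
  refine ⟨?_, fun u hu => ?_, fun u hu => ?_⟩
  · rw [state_eq, show 173 * 17 = 173 + 173 * 16 from rfl, pow_add]
    exact Nat.mul_lt_mul_of_pos_left (pack_lt hg173) (by positivity)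
  · have := hf u hu
    rw [testBit_state hg173 hu (by omega)]
    exact (hval u hu).2
  · rw [testBit_state hg173 hu (by omega)]
    exact Nat.testBit_lt_two_pow (hval u hu).1

/-! ### Codes as families of sets of ternary words -/

/-- The distance of the ternary words with the numbers `p` and `q`. -/
def ternaryDist (p q : ℕ) : ℕ :=
  (if p / 9 = q / 9 then 0 else 1) + (if p / 3 % 3 = q / 3 % 3 then 0 else 1) +
    (if p % 3 = q % 3 then 0 else 1)

/-- The sets `m v` of ternary words, for `v < 16`, form a code of minimum distance 3. -/
structure IsCode (m : ℕ → ℕ) : Prop where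
  lt : ∀ v < 16, m v < 2 ^ 27
  dist : ∀ u < 16, ∀ v < 16, ∀ p < 27, ∀ q < 27, (m u).testBit p = true →
    (m v).testBit q = true → (u ≠ v ∨ p ≠ q) → 3 ≤ weight (u ^^^ v) + ternaryDist p q

/-- The number of elements of a set of ternary words. -/
def pop (a : ℕ) : ℕ := ((Finset.range 27).filter fun p => a.testBit p = true).card

theorem lt_of_testBit {a p n : ℕ} (ha : a < 2 ^ n) (h : a.testBit p = true) : p < n := by
  by_contra hp
  rw [Nat.testBit_lt_two_pow (ha.trans_le (Nat.pow_le_pow_right (by norm_num) (not_lt.1 hp)))] at h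
  exact Bool.false_ne_true h

theorem eq_of_testBit {a b n : ℕ} (ha : a < 2 ^ n) (hb : b < 2 ^ n)
    (h : ∀ p < n, a.testBit p = true ↔ b.testBit p = true) : a = b := by
  refine Nat.eq_of_testBit_eq fun p => ?_
  rw [Bool.eq_iff_iff]
  exact ⟨fun hp => (h p (lt_of_testBit ha hp)).1 hp, fun hp => (h p (lt_of_testBit hb hp)).2 hp⟩

theorem ternaryDist_eq_zero : ∀ p < 27, ∀ q < 27, ternaryDist p q = 0 → p = q := by
  intro p _ q _ h
  unfold ternaryDist at h
  split_ifs at h <;> omega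

theorem ternaryDist_le (p q : ℕ) : ternaryDist p q ≤ 3 := by
  unfold ternaryDist
  split_ifs <;> omega

theorem testBit_two_pow_iff {p i : ℕ} : (2 ^ p).testBit i = true ↔ p = i := by
  rw [Nat.testBit_two_pow, decide_eq_true_iff]

theorem two_pow_lt {p : ℕ} (hp : p < 27) : 2 ^ p < 2 ^ 27 := Nat.pow_lt_pow_right (by norm_num) hp

theorem ternaryDist_eq_three_iff {p q : ℕ} : ternaryDist p q = 3 ↔
    p / 9 ≠ q / 9 ∧ p / 3 % 3 ≠ q / 3 % 3 ∧ p % 3 ≠ q % 3 := by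
  unfold ternaryDist
  split_ifs with h1 h2 h3 h3 h2 h3 h3 <;> simp [*]

/-- In each coordinate two words at distance 3 use two different symbols, so the third symbol is
forced. -/
theorem eq_of_ternaryDist_eq_three : ∀ p < 27, ∀ q < 27, ternaryDist p q = 3 →
    ∀ r < 27, ternaryDist p r = 3 → ternaryDist q r = 3 →
    ∀ t < 27, ternaryDist p t = 3 → ternaryDist q t = 3 → t = r := by
  intro p hp q hq h1 r hr h2 h3 t ht h4 h5
  rw [ternaryDist_eq_three_iff] at h1 h2 h3 h4 h5
  obtain ⟨a1, b1, c1⟩ := h1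
  obtain ⟨a2, b2, c2⟩ := h2
  obtain ⟨a3, b3, c3⟩ := h3
  obtain ⟨a4, b4, c4⟩ := h4
  obtain ⟨a5, b5, c5⟩ := h5
  have ha : t / 9 = r / 9 := by clear b1 b2 b3 b4 b5 c1 c2 c3 c4 c5; omega
  have hb : t / 3 % 3 = r / 3 % 3 := by clear a1 a2 a3 a4 a5 c1 c2 c3 c4 c5; omega
  have hc : t % 3 = r % 3 := by clear a1 a2 a3 a4 a5 b1 b2 b3 b4 b5; omega
  omega

set_option synthInstance.maxSize 1000 in
set_option synthInstance.maxHeartbeats 100000 in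
theorem triple_mem_codeMasks : ∀ p < 27, ∀ q < 27, ∀ r < 27,
    (ternaryDist p q = 3 ∧ ternaryDist p r = 3 ∧ ternaryDist q r = 3) →
      2 ^ p ||| 2 ^ q ||| 2 ^ r ∈ codeMasks := by decide +kernel

/-- Since the third word is determined by two others, such a set has at most three elements; what
remains is to look up the empty set, singletons, pairs and triples in the list. -/
theorem mem_codeMasks {a : ℕ} (ha : a < 2 ^ 27) (h : ∀ p < 27, ∀ q < 27, a.testBit p = true →
    a.testBit q = true → p ≠ q → ternaryDist p q = 3) : a ∈ codeMasks := by
  have k0 : 0 ∈ codeMasks := by decide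
  have k1 : ∀ p < 27, 2 ^ p ∈ codeMasks := by decide +kernel
  have k2 : ∀ p < 27, ∀ q < 27, ternaryDist p q = 3 → 2 ^ p ||| 2 ^ q ∈ codeMasks := by
    decide +kernel
  by_cases e1 : ∃ p < 27, a.testBit p = true
  swap
  · push Not at e1
    have : a = 0 := eq_of_testBit ha (by norm_num) fun p hp => by simp [e1 p hp]
    rwa [this]
  obtain ⟨p, hp, hap⟩ := e1
  by_cases e2 : ∃ q < 27, a.testBit q = true ∧ p ≠ q
  swap
  · push Not at e2
    have : a = 2 ^ p := eq_of_testBit ha (two_pow_lt hp) fun i hi => by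
      rw [testBit_two_pow_iff]
      exact ⟨e2 i hi, fun hpi => hpi ▸ hap⟩
    rw [this]
    exact k1 p hp
  obtain ⟨q, hq, haq, hpq⟩ := e2
  have dpq := h p hp q hq hap haq hpq
  by_cases e3 : ∃ r < 27, a.testBit r = true ∧ p ≠ r ∧ q ≠ r
  swap
  · push Not at e3
    have : a = 2 ^ p ||| 2 ^ q :=
      eq_of_testBit ha (Nat.or_lt_two_pow (two_pow_lt hp) (two_pow_lt hq)) fun i hi => by
      rw [Nat.testBit_or, Bool.or_eq_true, testBit_two_pow_iff, testBit_two_pow_iff]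
      constructor
      · intro hai
        by_cases hpi : p = i
        · exact Or.inl hpi
        · exact Or.inr (e3 i hi hai hpi)
      · rintro (rfl | rfl) <;> assumption
    rw [this]
    exact k2 p hp q hq dpq
  obtain ⟨r, hr, har, hpr, hqr⟩ := e3
  have dpr := h p hp r hr hap har hpr
  have dqr := h q hq r hr haq har hqr
  have : a = 2 ^ p ||| 2 ^ q ||| 2 ^ r :=
    eq_of_testBit ha (Nat.or_lt_two_pow (Nat.or_lt_two_pow (two_pow_lt hp) (two_pow_lt hq))
      (two_pow_lt hr)) fun i hi => by
    rw [Nat.testBit_or, Nat.testBit_or, Bool.or_eq_true, Bool.or_eq_true, testBit_two_pow_iff,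
      testBit_two_pow_iff, testBit_two_pow_iff]
    constructor
    · intro hai
      by_cases hpi : p = i
      · exact Or.inl (Or.inl hpi)
      by_cases hqi : q = i
      · exact Or.inl (Or.inr hqi)
      · exact Or.inr (eq_of_ternaryDist_eq_three p hp q hq dpq r hr dpr dqr i hi
          (h p hp i hi hap hai hpi) (h q hq i hi haq hai hqi)).symm
    · rintro ((rfl | rfl) | rfl) <;> assumption
  rw [this]
  exact triple_mem_codeMasks p hp q hq r hr ⟨dpq, dpr, dqr⟩

theorem IsCode.ternaryDist_eq {m : ℕ → ℕ} (hm : IsCode m) {v : ℕ} (hv : v < 16) :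
    ∀ p < 27, ∀ q < 27, (m v).testBit p = true → (m v).testBit q = true → p ≠ q →
      ternaryDist p q = 3 := by
  intro p hp q hq h1 h2 h3
  have := hm.dist v hv v hv p hp q hq h1 h2 (Or.inr h3)
  have hw : weight (v ^^^ v) = 0 := by simp [weight]
  have := ternaryDist_le p q
  omega

theorem IsCode.mem_codeMasks {m : ℕ → ℕ} (hm : IsCode m) {v : ℕ} (hv : v < 16) :
    m v ∈ codeMasks := MixedCode.mem_codeMasks (hm.lt v hv) (hm.ternaryDist_eq hv)

theorem length_codeMasks : codeMasks.length = 172 := by decide +kernel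

/-- The index of the set `m v` in the list of codes. -/
def indexOf (m : ℕ → ℕ) (v : ℕ) : ℕ := codeMasks.idxOf (m v)

theorem IsCode.indexOf_lt {m : ℕ → ℕ} (hm : IsCode m) {v : ℕ} (hv : v < 16) :
    indexOf m v < 172 := by
  rw [← length_codeMasks]
  exact List.idxOf_lt_length_of_mem (hm.mem_codeMasks hv)

theorem code_eq_getElem {c : ℕ} (hc : c < codeMasks.length) : code c = codeMasks[c] :=
  List.getD_eq_getElem _ _ hc

theorem IsCode.code_indexOf {m : ℕ → ℕ} (hm : IsCode m) {v : ℕ} (hv : v < 16) :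
    code (indexOf m v) = m v := by
  have h := List.idxOf_lt_length_of_mem (hm.mem_codeMasks hv)
  rw [indexOf, code_eq_getElem h, List.getElem_idxOf]

theorem size_eq_pop : ∀ c < 172, size c = pop (code c) := by decide +kernel

theorem IsCode.size_indexOf {m : ℕ → ℕ} (hm : IsCode m) {v : ℕ} (hv : v < 16) :
    size (indexOf m v) = pop (m v) := by
  rw [size_eq_pop _ (hm.indexOf_lt hv), hm.code_indexOf hv]

theorem exists_of_testBit_unionOf {l : List ℕ} {a p : ℕ} (h : (unionOf l a).testBit p = true) :
    ∃ q, ∃ hq : q < l.length, a.testBit q = true ∧ l[q].testBit p = true := by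
  induction l generalizing a with
  | nil => simp [unionOf] at h
  | cons b l ih =>
    have h1 : (((Bool.rec 0 b (Nat.beq (a % 2) 1) : ℕ)) ||| unionOf l (a / 2)).testBit p = true := h
    rw [Nat.testBit_or, Bool.or_eq_true] at h1
    rcases h1 with h1 | h1
    · refine ⟨0, by simp, ?_⟩
      cases h2 : Nat.beq (a % 2) 1 with
      | false => simp [h2] at h1
      | true =>
        rw [h2] at h1
        rw [Nat.testBit_zero, Nat.eq_of_beq_eq_true h2]
        exact ⟨rfl, h1⟩
    · obtain ⟨q, hq, h2, h3⟩ := ih h1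
      refine ⟨q + 1, by simpa using hq, ?_, by simpa using h3⟩
      rwa [Nat.testBit_succ]

theorem bits_codeMasks_lt (p : ℕ → Bool) : bits p codeMasks < 2 ^ 172 := by
  rw [← length_codeMasks]
  exact bits_lt p codeMasks

theorem testBit_table {g : ℕ → ℕ → Bool} {c c' : ℕ} (hc : c < 172) (hc' : c' < 172) :
    (rows 172 (fun a => bits (g a) codeMasks) codeMasks).testBit (172 * c + c') =
      g (code c) (code c') := by
  have h : c < codeMasks.length := by rwa [length_codeMasks]
  have h' : c' < codeMasks.length := by rwa [length_codeMasks]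
  rw [testBit_rows (fun a => bits_codeMasks_lt (g a)) _ _ _ h hc', testBit_bits _ _ _ h',
    code_eq_getElem h, code_eq_getElem h']

/-- Binary distance 1 leaves ternary distance at least 2, so one set avoids the radius-1
neighbourhood of the other; binary distance 2 leaves at least 1, so the sets are disjoint. -/
theorem IsCode.compatible {m : ℕ → ℕ} (hm : IsCode m) :
    Compatible farTable disjointTable (indexOf m) := by
  have hz : ∀ a b : ℕ, (∀ p, a.testBit p = true → b.testBit p = true → False) →
      Nat.beq (Nat.land a b) 0 = true := by
    intro a b h
    have : Nat.land a b = 0 := by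
      change a &&& b = 0
      refine Nat.eq_of_testBit_eq fun p => ?_
      rw [Nat.testBit_and, Nat.zero_testBit, Bool.eq_false_iff, Ne, Bool.and_eq_true]
      exact fun hp => h p hp.1 hp.2
    rw [this]
    rfl
  refine ⟨fun u hu => hm.indexOf_lt hu, fun u hu v hv huv => ?_, fun u hu v hv huv => ?_⟩
  · have e : farTable = rows 172 (fun a => bits (fun b => Nat.beq (Nat.land (unionOf balls a) b) 0)
        codeMasks) codeMasks := by
      unfold farTable
      simp only [force_eq]
    -- Only this inclusion matters: masks that were too small would prune less but exclude no
    -- genuine code.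
    have hballs : ∀ q < 27, ∀ p < 27, (balls.getD q 0).testBit p = true → ternaryDist q p ≤ 1 := by
      decide +kernel
    rw [e, testBit_table (g := fun a b => Nat.beq (Nat.land (unionOf balls a) b) 0)
      (hm.indexOf_lt hv) (hm.indexOf_lt hu), hm.code_indexOf hv, hm.code_indexOf hu]
    refine hz _ _ fun p h1 h2 => ?_
    obtain ⟨q, hq, h3, h4⟩ := exists_of_testBit_unionOf h1
    have hp := lt_of_testBit (hm.lt u hu) h2
    have hq' := lt_of_testBit (hm.lt v hv) h3
    have h5 := hballs q hq' p hp (by rwa [List.getD_eq_getElem _ _ hq])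
    have huv' : v ≠ u := by rintro rfl; simp [weight] at huv
    have h6 := hm.dist v hv u hu q hq' p hp h3 h2 (Or.inl huv')
    rw [Nat.xor_comm] at h6
    omega
  · have e : disjointTable = rows 172 (fun a => bits (fun b => Nat.beq (Nat.land a b) 0)
        codeMasks) codeMasks := rfl
    rw [e, testBit_table (g := fun a b => Nat.beq (Nat.land a b) 0)
      (hm.indexOf_lt hv) (hm.indexOf_lt hu), hm.code_indexOf hv, hm.code_indexOf hu]
    refine hz _ _ fun p h1 h2 => ?_
    have hp := lt_of_testBit (hm.lt u hu) h2
    have huv' : v ≠ u := by rintro rfl; simp [weight] at huv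
    have h6 := hm.dist v hv u hu p hp p hp h1 h2 (Or.inl huv')
    have h7 : ternaryDist p p = 0 := by simp [ternaryDist]
    rw [Nat.xor_comm] at h6
    omega

/-! ### Isometries -/

/-- The list `g` describes an isometry of the ternary space. -/
structure IsIsometry (g : List ℕ) : Prop where
  length : g.length = 27
  lt : ∀ p < 27, g.getD p 0 < 27
  dist : ∀ p < 27, ∀ q < 27, ternaryDist (g.getD p 0) (g.getD q 0) = ternaryDist p q

theorem IsIsometry.injective {g : List ℕ} (hg : IsIsometry g) {p q : ℕ} (hp : p < 27)
    (hq : q < 27) (h : g.getD p 0 = g.getD q 0) : p = q := by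
  refine ternaryDist_eq_zero p hp q hq ?_
  rw [← hg.dist p hp q hq, h]
  simp [ternaryDist]

theorem IsIsometry.surjective {g : List ℕ} (hg : IsIsometry g) {q : ℕ} (hq : q < 27) :
    ∃ p < 27, g.getD p 0 = q := by
  have := Finset.surj_on_of_inj_on_of_card_le (s := Finset.range 27) (t := Finset.range 27)
    (fun p _ => g.getD p 0) (fun p hp => Finset.mem_range.2 (hg.lt p (Finset.mem_range.1 hp)))
    (fun p q hp hq h => hg.injective (Finset.mem_range.1 hp) (Finset.mem_range.1 hq) h) le_rfl q
    (Finset.mem_range.2 hq)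
  obtain ⟨p, hp, h⟩ := this
  exact ⟨p, Finset.mem_range.1 hp, h.symm⟩

theorem IsIsometry.pull_lt {g : List ℕ} (hg : IsIsometry g) (a : ℕ) : pull g a < 2 ^ 27 := by
  rw [← hg.length]
  exact bits_lt _ _

theorem IsIsometry.testBit_pull {g : List ℕ} (hg : IsIsometry g) (a : ℕ) {p : ℕ} (hp : p < 27) :
    (pull g a).testBit p = a.testBit (g.getD p 0) := by
  have h : p < g.length := by rwa [hg.length]
  rw [pull, testBit_bits _ _ _ h, List.getD_eq_getElem _ _ h]

theorem IsIsometry.pop_pull {g : List ℕ} (hg : IsIsometry g) (a : ℕ) : pop (pull g a) = pop a := by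
  unfold pop
  refine Finset.card_bij (fun p _ => g.getD p 0) (fun p hp => ?_) (fun p hp q hq h => ?_)
    fun q hq => ?_
  · rw [Finset.mem_filter, Finset.mem_range] at hp ⊢
    exact ⟨hg.lt p hp.1, by rw [← hg.testBit_pull a hp.1]; exact hp.2⟩
  · rw [Finset.mem_filter, Finset.mem_range] at hp hq
    exact hg.injective hp.1 hq.1 h
  · rw [Finset.mem_filter, Finset.mem_range] at hq
    obtain ⟨p, hp, rfl⟩ := hg.surjective hq.1
    exact ⟨p, by rw [Finset.mem_filter, Finset.mem_range, hg.testBit_pull a hp]; exact ⟨hp, hq.2⟩,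
      rfl⟩

theorem IsCode.pull {m : ℕ → ℕ} (hm : IsCode m) {g : List ℕ} (hg : IsIsometry g) :
    IsCode fun v => pull g (m v) := by
  refine ⟨fun v _ => hg.pull_lt _, fun u hu v hv p hp q hq h1 h2 h => ?_⟩
  rw [hg.testBit_pull _ hp] at h1
  rw [hg.testBit_pull _ hq] at h2
  rw [← hg.dist p hp q hq]
  exact hm.dist u hu v hv _ (hg.lt p hp) _ (hg.lt q hq) h1 h2
    (h.imp_right fun h h' => h (hg.injective hp hq h'))

theorem IsCode.comp {m : ℕ → ℕ} (hm : IsCode m) {b : ℕ → ℕ} (hb : ∀ v < 16, b v < 16)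
    (hb' : ∀ u < 16, ∀ v < 16, weight (b u ^^^ b v) = weight (u ^^^ v)) :
    IsCode fun v => m (b v) := by
  have hw : ∀ u < 16, ∀ v < 16, weight (u ^^^ v) = 0 → u = v := by decide +kernel
  refine ⟨fun v hv => hm.lt _ (hb v hv), fun u hu v hv p hp q hq h1 h2 h => ?_⟩
  rw [← hb' u hu v hv]
  refine hm.dist _ (hb u hu) _ (hb v hv) p hp q hq h1 h2 (h.imp_left fun h h' => h ?_)
  refine hw u hu v hv ?_
  rw [← hb' u hu v hv, h']
  simp [weight]

theorem IsCode.translate {m : ℕ → ℕ} (hm : IsCode m) {t : ℕ} (ht : t < 16) :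
    IsCode fun v => m (v ^^^ t) := by
  refine hm.comp (fun v hv => Nat.xor_lt_two_pow (n := 4) hv ht) fun u _ v _ => ?_
  rw [Nat.xor_comm v t, Nat.xor_assoc, ← Nat.xor_assoc t t v, Nat.xor_self, Nat.zero_xor]

/-- The number of words in the `k`-th face. -/
def facePop (m : ℕ → ℕ) (k : ℕ) : ℕ :=
  pop (m k) + pop (m (k + 4)) + pop (m (k + 8)) + pop (m (k + 12))

/-- A code with at least 29 words whose largest face is the face 0, of size `s`. -/
structure IsLarge (s : ℕ) (m : ℕ → ℕ) : Prop where
  isCode : IsCode m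
  facePop_zero : facePop m 0 = s
  le_facePop_one : 15 - s ≤ facePop m 1
  facePop_two_le : facePop m 2 ≤ facePop m 1
  facePop_le : ∀ k < 4, facePop m k ≤ s
  card : 29 ≤ facePop m 0 + facePop m 1 + facePop m 2 + facePop m 3

theorem IsLarge.of_facePop_eq {s : ℕ} {m m' : ℕ → ℕ} (hm : IsLarge s m) (hm' : IsCode m')
    (h : ∀ k < 4, facePop m' k = facePop m k) : IsLarge s m' := by
  have h0 := h 0 (by norm_num)
  have h1 := h 1 (by norm_num)
  have h2 := h 2 (by norm_num)
  have h3 := h 3 (by norm_num)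
  refine ⟨hm', by rw [h0]; exact hm.facePop_zero, by rw [h1]; exact hm.le_facePop_one,
    by rw [h1, h2]; exact hm.facePop_two_le, fun k hk => by rw [h k hk]; exact hm.facePop_le k hk,
    by rw [h0, h1, h2, h3]; exact hm.card⟩

theorem IsLarge.pull {s : ℕ} {m : ℕ → ℕ} (hm : IsLarge s m) {g : List ℕ} (hg : IsIsometry g) :
    IsLarge s fun v => MixedCode.pull g (m v) :=
  hm.of_facePop_eq (hm.isCode.pull hg) fun k _ => by simp only [facePop, hg.pop_pull]

theorem IsLarge.translate {s : ℕ} {m : ℕ → ℕ} (hm : IsLarge s m) {j : ℕ} (hj : j < 4) :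
    IsLarge s fun v => m (v ^^^ (4 * j)) := by
  refine hm.of_facePop_eq (hm.isCode.translate (by omega)) fun k hk => ?_
  unfold facePop
  interval_cases j <;> interval_cases k <;> simp only [Nat.reduceMul, Nat.reduceAdd, Nat.reduceXor] <;>
    ring

/-- The exchange of the two last coordinates of the binary words. -/
def swapHigh (v : ℕ) : ℕ := v % 4 + v / 4 % 2 * 8 + v / 8 * 4

/-- The exchange of the two first coordinates of the binary words. -/
def swapLow (v : ℕ) : ℕ := v / 4 * 4 + v % 2 * 2 + v / 2 % 2

theorem IsCode.swapHigh {m : ℕ → ℕ} (hm : IsCode m) : IsCode fun v => m (swapHigh v) :=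
  hm.comp (by decide +kernel) (by decide +kernel)

theorem IsCode.swapLow {m : ℕ → ℕ} (hm : IsCode m) : IsCode fun v => m (swapLow v) :=
  hm.comp (by decide +kernel) (by decide +kernel)

theorem IsLarge.swapHigh {s : ℕ} {m : ℕ → ℕ} (hm : IsLarge s m) :
    IsLarge s fun v => m (swapHigh v) := by
  refine hm.of_facePop_eq hm.isCode.swapHigh fun k hk => ?_
  unfold facePop
  interval_cases k <;> simp only [MixedCode.swapHigh] <;> norm_num <;> ring

theorem IsCode.pop_le_three {m : ℕ → ℕ} (hm : IsCode m) {v : ℕ} (hv : v < 16) : pop (m v) ≤ 3 := by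
  rw [← hm.size_indexOf hv, size_eq]
  split_ifs <;> omega

theorem facePop_le_twelve {m : ℕ → ℕ} (hm : IsCode m) {k : ℕ} (hk : k < 4) :
    facePop m k ≤ 12 := by
  unfold facePop
  have := hm.pop_le_three (v := k) (by omega)
  have := hm.pop_le_three (v := k + 4) (by omega)
  have := hm.pop_le_three (v := k + 8) (by omega)
  have := hm.pop_le_three (v := k + 12) (by omega)
  omega

/-- A largest face has at least 29 / 4, hence 8, words. Translation by its number brings it to face
0, and exchanging the two low coordinates, which swaps faces 1 and 2, orders these two. -/
theorem exists_isLarge {m : ℕ → ℕ} (hm : IsCode m)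
    (h : 29 ≤ facePop m 0 + facePop m 1 + facePop m 2 + facePop m 3) :
    ∃ s m', 8 ≤ s ∧ s ≤ 12 ∧ IsLarge s m' := by
  obtain ⟨t, ht, hmax⟩ := Finset.exists_max_image (Finset.range 4) (facePop m) ⟨0, by simp⟩
  rw [Finset.mem_range] at ht
  set m₁ : ℕ → ℕ := fun v => m (v ^^^ t) with hm₁
  have hc₁ : IsCode m₁ := hm.translate (by omega)
  have hf : ∀ k < 4, facePop m₁ k = facePop m (k ^^^ t) := fun k hk => by
    simp only [facePop, hm₁]
    interval_cases t <;> interval_cases k <;> simp only [Nat.reduceAdd, Nat.reduceXor]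
  have f0 := hf 0 (by norm_num)
  have hle : ∀ k < 4, facePop m₁ k ≤ facePop m₁ 0 := fun k hk => by
    rw [hf k hk, f0, Nat.zero_xor]
    exact hmax _ (Finset.mem_range.2 (Nat.xor_lt_two_pow (n := 2) hk ht))
  have hsum : 29 ≤ facePop m₁ 0 + facePop m₁ 1 + facePop m₁ 2 + facePop m₁ 3 := by
    rw [hf 0 (by norm_num), hf 1 (by norm_num), hf 2 (by norm_num), hf 3 (by norm_num)]
    interval_cases t <;> simp only [Nat.reduceXor] <;> omega
  have g1 := hle 1 (by norm_num)
  have g2 := hle 2 (by norm_num)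
  have g3 := hle 3 (by norm_num)
  have g0 := facePop_le_twelve hc₁ (k := 0) (by norm_num)
  rcases le_total (facePop m₁ 2) (facePop m₁ 1) with h12 | h12
  · exact ⟨facePop m₁ 0, m₁, by omega, g0, hc₁, rfl, by omega, h12, hle, hsum⟩
  · set m₂ : ℕ → ℕ := fun v => m₁ (swapLow v) with hm₂
    have e0 : facePop m₂ 0 = facePop m₁ 0 := rfl
    have e1 : facePop m₂ 1 = facePop m₁ 2 := rfl
    have e2 : facePop m₂ 2 = facePop m₁ 1 := rfl
    have e3 : facePop m₂ 3 = facePop m₁ 3 := rfl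
    refine ⟨facePop m₁ 0, m₂, by omega, g0, hc₁.swapLow, e0, by omega, by omega, fun k hk => ?_,
      by omega⟩
    interval_cases k <;> omega

/-- The isometry that maps the words `000`, `111`, `222` to `x`, `y`, `z`. -/
def frame (x y z : ℕ) : List ℕ :=
  (List.range 27).map fun p => 9 * ([x, y, z].getD (p / 9) 0 / 9) +
    3 * ([x, y, z].getD (p / 3 % 3) 0 / 3 % 3) + [x, y, z].getD (p % 3) 0 % 3

theorem getD_triple {x y z : ℕ} (a : ℕ) (ha : a < 3) : [x, y, z].getD a 0 =
    if a = 0 then x else if a = 1 then y else z := by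
  interval_cases a <;> rfl

theorem getD_frame {x y z p : ℕ} (hp : p < 27) : (frame x y z).getD p 0 =
    9 * ([x, y, z].getD (p / 9) 0 / 9) +
    3 * ([x, y, z].getD (p / 3 % 3) 0 / 3 % 3) + [x, y, z].getD (p % 3) 0 % 3 := by
  unfold frame
  rw [List.getD_eq_getElem _ _ (by simpa using hp)]
  simp

theorem digits_combine {a b c : ℕ} (hb : b < 3) (hc : c < 3) : (9 * a + 3 * b + c) / 9 = a ∧
    (9 * a + 3 * b + c) / 3 % 3 = b ∧ (9 * a + 3 * b + c) % 3 = c := by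
  refine ⟨?_, ?_, ?_⟩ <;> omega

/-- Words at mutual distance 3 show all three symbols in every coordinate, so the map is a
permutation of the symbols in each coordinate. -/
theorem isIsometry_frame {x y z : ℕ} (hx : x < 27) (hy : y < 27) (hz : z < 27)
    (hxy : ternaryDist x y = 3) (hxz : ternaryDist x z = 3) (hyz : ternaryDist y z = 3) :
    IsIsometry (frame x y z) := by
  rw [ternaryDist_eq_three_iff] at hxy hxz hyz
  have hL : ∀ a < 3, [x, y, z].getD a 0 < 27 := fun a ha => by
    rw [getD_triple a ha]; split_ifs <;> assumption
  have key : ∀ d : ℕ → ℕ, d x ≠ d y → d x ≠ d z → d y ≠ d z → ∀ a < 3, ∀ b < 3,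
      d ([x, y, z].getD a 0) = d ([x, y, z].getD b 0) ↔ a = b := by
    intro d h1 h2 h3 a ha b hb
    rw [getD_triple a ha, getD_triple b hb]
    interval_cases a <;> interval_cases b <;> simp [h1, h2, h3, h1.symm, h2.symm, h3.symm]
  refine ⟨by simp [frame], fun p hp => ?_, fun p hp q hq => ?_⟩
  · have := hL (p / 9) (by omega)
    rw [getD_frame hp]
    omega
  · have a1 := digits_combine (a := [x, y, z].getD (p / 9) 0 / 9)
      (Nat.mod_lt ([x, y, z].getD (p / 3 % 3) 0 / 3) (by norm_num))
      (Nat.mod_lt ([x, y, z].getD (p % 3) 0) (by norm_num))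
    have a2 := digits_combine (a := [x, y, z].getD (q / 9) 0 / 9)
      (Nat.mod_lt ([x, y, z].getD (q / 3 % 3) 0 / 3) (by norm_num))
      (Nat.mod_lt ([x, y, z].getD (q % 3) 0) (by norm_num))
    rw [getD_frame hp, getD_frame hq]
    unfold ternaryDist
    rw [a1.1, a1.2.1, a1.2.2, a2.1, a2.2.1, a2.2.2]
    rw [if_congr (key (· / 9) hxy.1 hxz.1 hyz.1 _ (by omega) _ (by omega)) rfl rfl,
      if_congr (key (· / 3 % 3) hxy.2.1 hxz.2.1 hyz.2.1 _ (by omega) _ (by omega)) rfl rfl,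
      if_congr (key (· % 3) hxy.2.2 hxz.2.2 hyz.2.2 _ (by omega) _ (by omega)) rfl rfl]

theorem frame_zero {x y z : ℕ} : (frame x y z).getD 0 0 = x := by
  rw [getD_frame (by norm_num)]
  simp
  omega

theorem frame_thirteen {x y z : ℕ} : (frame x y z).getD 13 0 = y := by
  rw [getD_frame (by norm_num)]
  simp
  omega

theorem frame_twentySix {x y z : ℕ} : (frame x y z).getD 26 0 = z := by
  rw [getD_frame (by norm_num)]
  simp
  omega

/-- A set of three words at mutual distance 3 is equivalent to `000`, `111`, `222`. -/
theorem exists_pull_eq_triple {a : ℕ} (h : ∀ p < 27, ∀ q < 27, a.testBit p = true →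
    a.testBit q = true → p ≠ q → ternaryDist p q = 3) (h3 : pop a = 3) :
    ∃ g, IsIsometry g ∧ pull g a = code 136 := by
  obtain ⟨x, y, z, hxy, hxz, hyz, hS⟩ := Finset.card_eq_three.1 h3
  have hmem : ∀ p, p < 27 ∧ a.testBit p = true ↔ p = x ∨ p = y ∨ p = z := fun p => by
    have := Finset.ext_iff.1 hS p
    simpa using this
  have ⟨hx, ax⟩ := (hmem x).2 (by simp)
  have ⟨hy, ay⟩ := (hmem y).2 (by simp)
  have ⟨hz, az⟩ := (hmem z).2 (by simp)
  have hg := isIsometry_frame hx hy hz (h x hx y hy ax ay hxy) (h x hx z hz ax az hxz)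
    (h y hy z hz ay az hyz)
  refine ⟨frame x y z, hg, eq_of_testBit (hg.pull_lt a) (by decide +kernel) fun p hp => ?_⟩
  have hc : ∀ p < 27, (code 136).testBit p = true ↔ p = 0 ∨ p = 13 ∨ p = 26 := by decide +kernel
  have hp' := hg.lt p hp
  rw [hg.testBit_pull a hp, hc p hp]
  have h4 := hmem ((frame x y z).getD p 0)
  constructor
  · intro h5
    rcases h4.1 ⟨hp', h5⟩ with h6 | h6 | h6
    · exact Or.inl (hg.injective hp (by norm_num) (h6.trans frame_zero.symm))
    · exact Or.inr (Or.inl (hg.injective hp (by norm_num) (h6.trans frame_thirteen.symm)))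
    · exact Or.inr (Or.inr (hg.injective hp (by norm_num) (h6.trans frame_twentySix.symm)))
  · rintro (rfl | rfl | rfl)
    · rwa [frame_zero]
    · rwa [frame_thirteen]
    · rwa [frame_twentySix]

theorem exists_ternaryDist_eq_three {x y : ℕ} (hx : x < 27) (hy : y < 27)
    (h : ternaryDist x y = 3) : ∃ z < 27, ternaryDist x z = 3 ∧ ternaryDist y z = 3 := by
  have key : ∀ x < 27, ∀ y < 27, ternaryDist x y = 3 →
    ∃ z < 27, ternaryDist x z = 3 ∧ ternaryDist y z = 3 := by decide +kernel
  exact key x hx y hy h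

/-- A set of two words at distance 3 is equivalent to `000`, `111`. -/
theorem exists_pull_eq_pair {a : ℕ} (h : ∀ p < 27, ∀ q < 27, a.testBit p = true →
    a.testBit q = true → p ≠ q → ternaryDist p q = 3) (h2 : pop a = 2) :
    ∃ g, IsIsometry g ∧ pull g a = code 28 := by
  obtain ⟨x, y, hxy, hS⟩ := Finset.card_eq_two.1 h2
  have hmem : ∀ p, p < 27 ∧ a.testBit p = true ↔ p = x ∨ p = y := fun p => by
    have := Finset.ext_iff.1 hS p
    simpa using this
  have ⟨hx, ax⟩ := (hmem x).2 (by simp)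
  have ⟨hy, ay⟩ := (hmem y).2 (by simp)
  have dxy := h x hx y hy ax ay hxy
  obtain ⟨z, hz, dxz, dyz⟩ := exists_ternaryDist_eq_three hx hy dxy
  have hg := isIsometry_frame hx hy hz dxy dxz dyz
  refine ⟨frame x y z, hg, eq_of_testBit (hg.pull_lt a) (by decide +kernel) fun p hp => ?_⟩
  have hc : ∀ p < 27, (code 28).testBit p = true ↔ p = 0 ∨ p = 13 := by decide +kernel
  have hp' := hg.lt p hp
  rw [hg.testBit_pull a hp, hc p hp]
  have h4 := hmem ((frame x y z).getD p 0)
  constructor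
  · intro h5
    rcases h4.1 ⟨hp', h5⟩ with h6 | h6
    · exact Or.inl (hg.injective hp (by norm_num) (h6.trans frame_zero.symm))
    · exact Or.inr (hg.injective hp (by norm_num) (h6.trans frame_thirteen.symm))
  · rintro (rfl | rfl)
    · rwa [frame_zero]
    · rwa [frame_thirteen]

theorem isIsometry_of_mem_symmetries : ∀ g ∈ symmetries, IsIsometry g := by
  have h : ∀ g ∈ symmetries, g.length = 27 ∧ (∀ p < 27, g.getD p 0 < 27) ∧
      ∀ p < 27, ∀ q < 27, ternaryDist (g.getD p 0) (g.getD q 0) = ternaryDist p q := by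
    decide +kernel
  exact fun g hg => ⟨(h g hg).1, (h g hg).2.1, (h g hg).2.2⟩

/-- The symmetry tests act after the set at vertex 0 has been fixed, so the symmetries must
stabilise it. -/
theorem pull_triple : ∀ g ∈ symmetries, pull g (code 136) = code 136 := by decide +kernel

theorem pull_pair : ∀ g ∈ symmetries, pull g (code 28) = code 28 := by decide +kernel

/-! ### The upper bound -/

/-- A large code with the set `code c` at the vertex 0, in which the other sets of the face 0 have
sizes satisfying `P`. -/
structure IsRooted (c : ℕ) (P : ℕ → Prop) (s : ℕ) (m : ℕ → ℕ) : Prop where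
  isLarge : IsLarge s m
  zero : m 0 = code c
  pop : ∀ u < 16, u % 4 = 0 → u ≠ 0 → P (pop (m u))

theorem IsRooted.pull {c s : ℕ} {P : ℕ → Prop} {m : ℕ → ℕ} (hm : IsRooted c P s m) {g : List ℕ}
    (hg : IsIsometry g) (hc : MixedCode.pull g (code c) = code c) :
    IsRooted c P s fun v => MixedCode.pull g (m v) :=
  ⟨hm.isLarge.pull hg, by rw [hm.zero, hc], fun u hu h1 h2 => by
    rw [hg.pop_pull]; exact hm.pop u hu h1 h2⟩

theorem IsRooted.swapHigh {c s : ℕ} {P : ℕ → Prop} {m : ℕ → ℕ} (hm : IsRooted c P s m) :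
    IsRooted c P s fun v => m (swapHigh v) :=
  have h : ∀ u < 16, u % 4 = 0 → u ≠ 0 → MixedCode.swapHigh u < 16 ∧
      MixedCode.swapHigh u % 4 = 0 ∧ MixedCode.swapHigh u ≠ 0 := by decide +kernel
  ⟨hm.isLarge.swapHigh, hm.zero, fun u hu h1 h2 =>
    hm.pop _ (h u hu h1 h2).1 (h u hu h1 h2).2.1 (h u hu h1 h2).2.2⟩

theorem exists_maximal {α : Type} {p : α → Prop} (key : α → ℕ) {B : ℕ} (hB : ∀ a, p a → key a ≤ B)
    {a : α} (ha : p a) : ∃ a, p a ∧ ∀ a', p a' → key a' ≤ key a := by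
  have hb : BddAbove (key '' {a | p a}) := ⟨B, by rintro _ ⟨a', h', rfl⟩; exact hB a' h'⟩
  obtain ⟨a₀, h0, h1⟩ := Nat.sSup_mem (s := key '' {a | p a}) ⟨_, a, ha, rfl⟩ hb
  exact ⟨a₀, h0, fun a' h' => h1 ▸ le_csSup hb ⟨a', h', rfl⟩⟩

/-- As `m 4 < 2 ^ 27`, the key orders the pairs `(m 12, m 4)` lexicographically. -/
theorem IsRooted.exists_maximal {c s : ℕ} {P : ℕ → Prop} {m : ℕ → ℕ} (hm : IsRooted c P s m) :
    ∃ m, IsRooted c P s m ∧ ∀ m', IsRooted c P s m' →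
      m' 12 * 2 ^ 27 + m' 4 ≤ m 12 * 2 ^ 27 + m 4 := by
  refine MixedCode.exists_maximal (fun m' : ℕ → ℕ => m' 12 * 2 ^ 27 + m' 4)
    (B := 2 ^ 27 * 2 ^ 27 + 2 ^ 27) (fun m' hm' => ?_) hm
  have h1 := hm'.isLarge.isCode.lt 12 (by norm_num)
  have h2 := hm'.isLarge.isCode.lt 4 (by norm_num)
  gcongr

theorem blt_eq_decide (a b : ℕ) : Nat.blt a b = decide (a < b) := ble_eq_decide _ _

/-- A symmetry test that fired would produce a rooted code with a larger key; the other tests only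
compare face sizes, which `IsLarge` controls. -/
theorem IsRooted.passes {c s : ℕ} {P : ℕ → Prop} {m : ℕ → ℕ} (hm : IsRooted c P s m)
    (hmax : ∀ m', IsRooted c P s m' → m' 12 * 2 ^ 27 + m' 4 ≤ m 12 * 2 ^ 27 + m 4)
    (hc : ∀ g ∈ symmetries, MixedCode.pull g (code c) = code c) :
    Passes (indexOf m) (levels s) [] := by
  have hC := hm.isLarge.isCode
  have hcode : ∀ v < 16, code (indexOf m v) = m v := fun v hv => hC.code_indexOf hv
  have hsize : ∀ v < 16, size (indexOf m v) = MixedCode.pop (m v) := fun v hv => hC.size_indexOf hv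
  have c4 := hcode 4 (by norm_num)
  have c8 := hcode 8 (by norm_num)
  have c12 := hcode 12 (by norm_num)
  have l4 := hC.lt 4 (by norm_num)
  have hg : ∀ g ∈ symmetries, MixedCode.pull g (m 12) * 2 ^ 27 + MixedCode.pull g (m 4) ≤
      m 12 * 2 ^ 27 + m 4 := fun g hg =>
    hmax (fun v => MixedCode.pull g (m v)) (hm.pull (isIsometry_of_mem_symmetries g hg) (hc g hg))
  have f0 := hm.isLarge.facePop_zero
  have f1 := hm.isLarge.facePop_le 1 (by norm_num)
  have f2 := hm.isLarge.facePop_two_le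
  unfold facePop at f0 f1 f2
  refine ⟨rfl, ?_, ?_, ?_, rfl, rfl, rfl, ?_, rfl, rfl, rfl, ?_, rfl, rfl, rfl, rfl, trivial⟩
  · simp only [exceeded₁, List.any_eq_false, blt_eq_decide, decide_eq_true_eq]
    intro g h
    have := hg g h
    rw [c12]
    omega
  · simp only [exceeded₂, List.any_eq_false, blt_eq_decide, Bool.and_eq_true, Nat.beq_eq,
      decide_eq_true_eq]
    intro g h
    have := hg g h
    rw [c12, c4]
    rintro ⟨h1, h2⟩
    rw [← h1] at this
    omega
  · have := hmax _ hm.swapHigh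
    simp only [MixedCode.swapHigh] at this
    norm_num at this
    simp only [large₀, blt_eq_decide, Bool.or_eq_false_iff, decide_eq_false_iff_not, c4, c8]
    rw [hsize 0 (by norm_num), hsize 12 (by norm_num), hsize 4 (by norm_num),
      hsize 8 (by norm_num)]
    norm_num at f0
    omega
  · simp only [large₁, blt_eq_decide, decide_eq_false_iff_not]
    rw [hsize 1 (by norm_num), hsize 13 (by norm_num), hsize 5 (by norm_num),
      hsize 9 (by norm_num)]
    norm_num at f1
    omega
  · simp only [large₂, blt_eq_decide, decide_eq_false_iff_not]
    rw [hsize 1 (by norm_num), hsize 13 (by norm_num), hsize 5 (by norm_num),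
      hsize 9 (by norm_num), hsize 2 (by norm_num), hsize 14 (by norm_num), hsize 6 (by norm_num),
      hsize 10 (by norm_num)]
    norm_num at f2
    omega

theorem searchFrom_eq (s c D : ℕ) : searchFrom s c D =
    search s farTable disjointTable (levels s) [] (start c D) := by
  unfold searchFrom
  rw [force_eq, force_eq, force_eq]

theorem levels_lt (s : ℕ) : ∀ p ∈ levels s, p.1 < 16 := by
  simp [levels]

/-- A successful search excludes rooted codes. -/
theorem not_isRooted {c s D : ℕ} {P : ℕ → Prop} {m : ℕ → ℕ} (hD : D < 2 ^ 172)
    (hPD : ∀ d < 172, P (size d) → D.testBit d = true)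
    (hc : ∀ g ∈ symmetries, MixedCode.pull g (code c) = code c)
    (hi : codeMasks.idxOf (code c) = c) (h : searchFrom s c D = true) : ¬ IsRooted c P s m := by
  intro h0
  -- The search keeps only maximal representatives, so the given code is replaced by one.
  obtain ⟨m, hm, hmax⟩ := h0.exists_maximal
  have hC := hm.isLarge.isCode
  have hlt : ∀ u < 16, indexOf m u < 172 := fun u hu => hC.indexOf_lt hu
  have hface : ∀ k < 4, faceSize (indexOf m) k = facePop m k := fun k hk => by
    unfold faceSize facePop
    rw [hC.size_indexOf (by omega), hC.size_indexOf (by omega), hC.size_indexOf (by omega),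
      hC.size_indexOf (by omega)]
  have f0 := hface 0 (by norm_num)
  have f1 := hface 1 (by norm_num)
  have f2 := hface 2 (by norm_num)
  have f3 := hface 3 (by norm_num)
  have hstart : Fits (indexOf m) (start c D) := by
    refine fits_start hlt ?_ hD fun u hu h1 h2 => hPD _ (hlt u hu) ?_
    · rw [indexOf, hm.zero, hi]
    · rw [hC.size_indexOf hu]
      exact hm.pop u hu h1 h2
  have := search_eq_false (s := s) hC.compatible (fun X hX => hX.bound_eq_true hlt
    (by rw [f0]; exact hm.isLarge.facePop_zero) (by rw [f1]; exact hm.isLarge.le_facePop_one)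
    (fun k hk => by rw [hface k hk]; exact hm.isLarge.facePop_le k hk)
    (by rw [f0, f1, f2, f3]; exact hm.isLarge.card)) (levels s) (levels_lt s) [] _ hstart
    (hm.passes hmax hc)
  rw [searchFrom_eq, this] at h
  exact Bool.false_ne_true h

theorem searchFrom_triple {s : ℕ} (h8 : 8 ≤ s) (h12 : s ≤ 12) :
    searchFrom s 136 (2 ^ 172 - 1) = true := by
  rcases h8.eq_or_lt with rfl | h9
  · exact searchFrom_triple_eight
  · refine searchFrom_triple_of_nine_le s ?_
    simp only [List.mem_cons, List.not_mem_nil, or_false]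
    omega

theorem not_isLarge_of_pop_eq_three {s : ℕ} (h8 : 8 ≤ s) (h12 : s ≤ 12) {m : ℕ → ℕ}
    (h3 : pop (m 0) = 3) : ¬ IsLarge s m := by
  intro hm
  obtain ⟨g, hg, h⟩ := exists_pull_eq_triple (hm.isCode.ternaryDist_eq (by norm_num)) h3
  refine not_isRooted (c := 136) (P := fun _ => True) (m := fun v => pull g (m v))
    (D := 2 ^ 172 - 1) (by norm_num) (fun d hd _ => ?_) pull_triple (by decide +kernel)
    (searchFrom_triple h8 h12) ⟨hm.pull hg, h, fun _ _ _ _ => trivial⟩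
  rw [Nat.testBit_two_pow_sub_one]
  simpa using hd

theorem not_isLarge_of_pop_eq_two {m : ℕ → ℕ} (h2 : ∀ u < 16, u % 4 = 0 → pop (m u) = 2) :
    ¬ IsLarge 8 m := by
  intro hm
  obtain ⟨g, hg, h⟩ := exists_pull_eq_pair (hm.isCode.ternaryDist_eq (by norm_num))
    (h2 0 (by norm_num) rfl)
  have hD : ∀ d < 172, size d = 2 → (2 ^ 136 - 2 ^ 28).testBit d = true := by decide +kernel
  exact not_isRooted (c := 28) (P := fun n => n = 2) (m := fun v => pull g (m v))
    (D := 2 ^ 136 - 2 ^ 28) (by norm_num) hD pull_pair (by decide +kernel)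
    searchFrom_pair_eight ⟨hm.pull hg, h, fun u hu h1 _ => by
      rw [hg.pop_pull]; exact h2 u hu h1⟩

theorem not_isLarge {s : ℕ} (h8 : 8 ≤ s) (h12 : s ≤ 12) (m : ℕ → ℕ) : ¬ IsLarge s m := by
  intro hm
  -- Translation by `4 * j` preserves every face and brings the vertex `4 * j` to 0.
  have key : ∀ j < 4, pop (m (4 * j)) ≠ 3 := fun j hj h3 =>
    not_isLarge_of_pop_eq_three h8 h12 (m := fun v => m (v ^^^ (4 * j)))
      (by rwa [Nat.zero_xor]) (hm.translate hj)
  have k0 := key 0 (by norm_num)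
  have k1 := key 1 (by norm_num)
  have k2 := key 2 (by norm_num)
  have k3 := key 3 (by norm_num)
  have p0 := hm.isCode.pop_le_three (v := 0) (by norm_num)
  have p1 := hm.isCode.pop_le_three (v := 4) (by norm_num)
  have p2 := hm.isCode.pop_le_three (v := 8) (by norm_num)
  have p3 := hm.isCode.pop_le_three (v := 12) (by norm_num)
  have f0 := hm.facePop_zero
  unfold facePop at f0
  norm_num at f0 k0 k1 k2 k3
  -- Four sets of at most two words with at least eight in total are four pairs.
  have hs : s = 8 := by omega
  subst hs
  refine not_isLarge_of_pop_eq_two (fun u hu h4 => ?_) hm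
  have : u = 0 ∨ u = 4 ∨ u = 8 ∨ u = 12 := by omega
  rcases this with rfl | rfl | rfl | rfl <;> omega

theorem IsCode.sum_facePop_le {m : ℕ → ℕ} (hm : IsCode m) :
    facePop m 0 + facePop m 1 + facePop m 2 + facePop m 3 ≤ 28 := by
  by_contra h
  obtain ⟨s, m', h8, h12, h'⟩ := exists_isLarge hm (by omega)
  exact not_isLarge h8 h12 m' h'

/-! ### Words and numbers -/

/-- The ternary word with the number `p`. -/
def ternaryWord (p : ℕ) : Fin 3 → ZMod 3 := ![(p / 9 : ℕ), (p / 3 % 3 : ℕ), (p % 3 : ℕ)]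

/-- The binary word with the number `v`. -/
def binaryWord (v : ℕ) : Fin 4 → ZMod 2 :=
  ![(v % 2 : ℕ), (v / 2 % 2 : ℕ), (v / 4 % 2 : ℕ), (v / 8 % 2 : ℕ)]

theorem hammingDist_ternaryWord : ∀ p < 27, ∀ q < 27,
    hammingDist (ternaryWord p) (ternaryWord q) = ternaryDist p q := by decide +kernel

theorem hammingDist_binaryWord : ∀ u < 16, ∀ v < 16,
    hammingDist (binaryWord u) (binaryWord v) = weight (u ^^^ v) := by decide +kernel

theorem exists_ternaryWord_eq : ∀ w : Fin 3 → ZMod 3, ∃ p < 27, ternaryWord p = w := by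
  decide +kernel

theorem exists_binaryWord_eq : ∀ w : Fin 4 → ZMod 2, ∃ v < 16, binaryWord v = w := by
  decide +kernel

theorem le_minDist_iff {b t : ℕ} {C : Finset (MixedWord b t)} {d : ℕ} :
    (d : ℕ∞) ≤ minDist C ↔ ∀ w ∈ C, ∀ x ∈ C, w ≠ x → d ≤ dist w x := by
  simp only [minDist, le_iInf_iff, Nat.cast_le]

/-- The ternary words which `C` contains together with the binary word number `v`. -/
noncomputable def wordsOver (C : Finset (MixedWord 4 3)) (v : ℕ) : ℕ :=
  bits (fun p => decide ((ternaryWord p, binaryWord v) ∈ C)) (List.range 27)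

theorem testBit_wordsOver {C : Finset (MixedWord 4 3)} {v p : ℕ} (hp : p < 27) :
    (wordsOver C v).testBit p = true ↔ (ternaryWord p, binaryWord v) ∈ C := by
  rw [wordsOver, testBit_bits _ _ _ (by simpa using hp), List.getElem_range, decide_eq_true_iff]

theorem isCode_wordsOver {C : Finset (MixedWord 4 3)} (hC : 3 ≤ minDist C) :
    IsCode (wordsOver C) := by
  have hC' := le_minDist_iff.1 hC
  refine ⟨fun v _ => ?_, fun u hu v hv p hp q hq h1 h2 h => ?_⟩
  · have := bits_lt (fun p => decide ((ternaryWord p, binaryWord v) ∈ C)) (List.range 27)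
    rwa [List.length_range] at this
  · rw [testBit_wordsOver hp] at h1
    rw [testBit_wordsOver hq] at h2
    have hB := hammingDist_binaryWord u hu v hv
    have hT := hammingDist_ternaryWord p hp q hq
    have := hC' _ h1 _ h2 fun e => by
      obtain ⟨e1, e2⟩ := Prod.ext_iff.1 e
      simp only at e1 e2
      rw [e1, hammingDist_self] at hT
      rw [e2, hammingDist_self] at hB
      have hw : ∀ u < 16, ∀ v < 16, weight (u ^^^ v) = 0 → u = v := by decide +kernel
      rcases h with h | h
      · exact h (hw u hu v hv hB.symm)
      · exact h (ternaryDist_eq_zero p hp q hq hT.symm)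
    rwa [dist, distB, distT, hB, hT] at this

theorem card_le_sum_pop (C : Finset (MixedWord 4 3)) :
    C.card ≤ ∑ v ∈ Finset.range 16, pop (wordsOver C v) := by
  unfold pop
  rw [← Finset.card_sigma]
  refine Finset.card_le_card_of_surjOn (fun x => (ternaryWord x.2, binaryWord x.1)) ?_
  rintro ⟨w₁, w₂⟩ hw
  obtain ⟨p, hp, rfl⟩ := exists_ternaryWord_eq w₁
  obtain ⟨v, hv, rfl⟩ := exists_binaryWord_eq w₂
  refine ⟨⟨v, p⟩, ?_, rfl⟩
  simp only [Finset.coe_sigma, Set.mem_sigma_iff, Finset.mem_coe, Finset.mem_filter,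
    Finset.mem_range]
  exact ⟨hv, hp, (testBit_wordsOver hp).2 hw⟩

theorem card_le {C : Finset (MixedWord 4 3)} (hC : 3 ≤ minDist C) : C.card ≤ 28 := by
  have h1 := card_le_sum_pop C
  have h2 := (isCode_wordsOver hC).sum_facePop_le
  simp only [Finset.sum_range_succ, Finset.sum_range_zero] at h1
  simp only [facePop] at h2
  norm_num at h2
  omega

/-! ### The explicit code and the pigeonhole argument -/

theorem card_code28 : code28.card = 28 := by decide +kernel

theorem minDist_code28 : minDist code28 = 3 := by
  refine le_antisymm ?_ (le_minDist_iff (d := 3).2 ?_)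
  · refine (iInf₂_le (![0, 0, 0], ![0, 0, 0, 0]) (by decide +kernel)).trans ?_
    refine (iInf₂_le (![0, 0, 1], ![0, 1, 0, 1]) (by decide +kernel)).trans ?_
    refine (iInf_le _ (by decide +kernel)).trans ?_
    have : dist (b := 4) (t := 3) (![0, 0, 0], ![0, 0, 0, 0]) (![0, 0, 1], ![0, 1, 0, 1]) = 3 := by
      decide +kernel
    rw [this]
    exact le_rfl
  · decide +kernel

theorem exists_distT_eq_three {C : Finset (MixedWord 4 3)} (hC : 3 ≤ minDist C)
    (h : 17 ≤ C.card) :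
    ∃ w ∈ C, ∃ x ∈ C, dist w x = 3 ∧ distT w x = 3 ∧ distB w x = 0 := by
  -- There are only 16 binary words, so two codewords share their binary part; they then differ in
  -- at most three places, all ternary.
  have hcard : (Finset.univ : Finset (Fin 4 → ZMod 2)).card < C.card := by
    rw [Finset.card_univ, Fintype.card_fun, ZMod.card, Fintype.card_fin]
    omega
  obtain ⟨w, hw, x, hx, hne, he⟩ := Finset.exists_ne_map_eq_of_card_lt_of_maps_to hcard
    (f := Prod.snd) fun _ _ => Finset.mem_univ _
  have h3 : 3 ≤ dist w x := le_minDist_iff (d := 3).1 hC w hw x hx hne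
  have hB : distB w x = 0 := by rw [distB, he, hammingDist_self]
  have hT : distT w x ≤ 3 := by
    have := hammingDist_le_card_fintype (x := w.1) (y := x.1)
    rwa [Fintype.card_fin] at this
  have hd : dist w x = distB w x + distT w x := rfl
  exact ⟨w, hw, x, hx, by omega, by omega, hB⟩

end MixedCode

theorem mainTheorem2 :
    MixedCode.N 4 3 3 = 28 ∧
    (∀ C : Finset (MixedWord 4 3), 3 ≤ MixedCode.minDist C → 17 ≤ C.card →
      ∃ w ∈ C, ∃ x ∈ C,
        MixedCode.dist w x = 3 ∧ MixedCode.distT w x = 3 ∧ MixedCode.distB w x = 0) ∧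
    (MixedCode.code28.card = 28 ∧ MixedCode.minDist MixedCode.code28 = 3) ∧
    IsGreatest {n | ∃ C : Finset (MixedWord 4 3), 3 ≤ MixedCode.minDist C ∧
      (![0, 0, 0], ![0, 0, 0, 0]) ∈ C ∧ (![1, 1, 1], ![0, 0, 0, 0]) ∈ C ∧ C.card = n} 28 := by
  refine ⟨(MixedCode.isGreatest_N 4 3 3).unique ⟨⟨MixedCode.code28,
      MixedCode.minDist_code28.ge, MixedCode.card_code28⟩, ?_⟩,
    fun C hC h => MixedCode.exists_distT_eq_three hC h,
    ⟨MixedCode.card_code28, MixedCode.minDist_code28⟩,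
    -- The explicit code already contains both prescribed words, and the upper bound holds for all
    -- codes.
    ⟨MixedCode.code28, MixedCode.minDist_code28.ge, by decide +kernel, by decide +kernel,
      MixedCode.card_code28⟩, ?_⟩
  · rintro _ ⟨C, hC, rfl⟩
    exact MixedCode.card_le hC
  · rintro _ ⟨C, hC, -, -, rfl⟩
    exact MixedCode.card_le hC
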